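/- Let $Q=(q_{ij})_{i,j\ge 0}$ be a skip-free generator matrix on $\{0,1,2,\dots\}$: $q_{ij}\ge 0$ for $i\ne j$, $q_{i,i+1}>0$, $q_{ij}=0$ for $j>i+1$, and $\sum_{j=0}^{i+1}q_{ij}=0$ for all $i\ge 0$. Let $(X_t)_{t\ge 0}$ be a Markov process on $\{0,1,2,\dots\}$ with generator $Q$ and $X_0=0$ almost surely; that is, its embedded chain $(Y_k)_{k\ge0}$ is a Markov chain started at $0$ with transition probabilities $p_{xy}=-q_{xy}/q_{xx}$ for $x\neq y$ and $p_{xx}=0$, and, for every $m\ge0$, given $Y_0,\dots,Y_m$ the first $m+1$ holding times are independent and exponential with rates $-q_{Y_kY_k}$, $0\le k\le m$. (Nothing is assumed about $X$ after a possible explosion.) Let $n\ge 0$, let $Q_n=(q_{ij})_{0\le i,j\le n-1}$, let $T_n=\inf\{t\ge 0: X_t=n\}$, and let $l_{T_n}^i=\int_0^{T_n}1_{\{X_s=i\}}\,ds$ for $0\le i\le n-1$. If $Q_n$ is not tridiagonal, that is, if $q_{ij}\neq 0$ for some $0\le i,j\le n-1$ with $|i-j|\ge 2$, then the sequence $(l_{T_n}^0,l_{T_n}^1,\dots,l_{T_n}^{n-1})$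 does not satisfy the Markov property: it is not the case that, for every $1\le k\le n-1$, the conditional distribution of $l_{T_n}^k$ given $(l_{T_n}^{0},\dots,l_{T_n}^{k-1})$ coincides almost surely with its conditional distribution given $l_{T_n}^{k-1}$ alone. -/

import Mathlib

open scoped NNReal ENNReal

namespace SkipFree

/-- `Q` is the generator matrix of a skip-free (to the left) process on `{0, 1, 2, …}`:
the off-diagonal entries are nonnegative rates, `q_{i,i+1} > 0`, `q_{ij} = 0` for `j > i + 1`,
and every row sums to zero. -/
structure IsSkipFreeGenerator (Q : Matrix ℕ ℕ ℝ) : Prop where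
  nonneg_of_ne : ∀ i j, i ≠ j → 0 ≤ Q i j
  up_pos : ∀ i, 0 < Q i (i + 1)
  skip_free : ∀ i j, i + 1 < j → Q i j = 0
  row_sum : ∀ i, ∑ j ∈ Finset.range (i + 2), Q i j = 0

/-- The upper left `n × n` submatrix `Q_n`, with rows and columns `0, …, n - 1`. -/
def upperSubmatrix (Q : Matrix ℕ ℕ ℝ) (n : ℕ) : Matrix (Fin n) (Fin n) ℝ :=
  Q.submatrix (fun i => (i : ℕ)) (fun j => (j : ℕ))

/-- A square matrix is tridiagonal if all entries at distance at least two from the diagonal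
vanish. -/
def IsTridiagonal {n : ℕ} (A : Matrix (Fin n) (Fin n) ℝ) : Prop :=
  ∀ i j : Fin n, ((i : ℕ) + 1 < (j : ℕ) ∨ (j : ℕ) + 1 < (i : ℕ)) → A i j = 0

/-- One step transition probabilities of the embedded chain, `p_{xy} = -q_{xy} / q_{xx}` for
`x ≠ y` and `p_{xx} = 0`. (A skip-free generator has `q_{xx} < 0` for every `x`.) -/
noncomputable def jumpProb (Q : Matrix ℕ ℕ ℝ) (x y : ℕ) : ℝ :=
  if x = y then 0 else -Q x y / Q x x

/-- The time `S_k` of the `k`-th transition, given the holding times; `S_0 = 0`. -/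
noncomputable def transitionTime {Ω : Type*} (H : ℕ → Ω → ℝ≥0) (k : ℕ) (ω : Ω) : ℝ≥0 :=
  ∑ m ∈ Finset.range k, H m ω

/-- The process `X` moves as a Markov jump process with generator `Q` started at `x₀`, whose
successive states are `Y 0, Y 1, …` and whose successive holding times are `H 0, H 1, …`.
Nothing is required of `X` after a possible explosion, that is, after the supremum of the
transition times. -/
structure IsJumpDescription {Ω : Type*} [MeasurableSpace Ω] (μ : MeasureTheory.Measure Ω)
    (Q : Matrix ℕ ℕ ℝ) (x₀ : ℕ) (X : ℝ≥0 → Ω → ℕ) (Y : ℕ → Ω → ℕ) (H : ℕ → Ω → ℝ≥0) :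
    Prop where
  measurable_state : ∀ k, Measurable (Y k)
  measurable_holding : ∀ k, Measurable (H k)
  /-- `X` stays at `Y k` during `[S_k, S_{k+1})`. -/
  path : ∀ᵐ ω ∂μ, ∀ (k : ℕ) (t : ℝ≥0),
    transitionTime H k ω ≤ t → t < transitionTime H (k + 1) ω → X t ω = Y k ω
  /-- `Y` is the Markov chain started at `x₀` with transition probabilities `jumpProb Q`. -/
  jump_chain : ∀ (m : ℕ) (y : ℕ → ℕ),
    μ {ω | ∀ k ≤ m, Y k ω = y k} =
      ENNReal.ofReal ((if y 0 = x₀ then 1 else 0) *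
        ∏ k ∈ Finset.range m, jumpProb Q (y k) (y (k + 1)))
  /-- Given `Y 0, …, Y m`, the holding times `H 0, …, H m` are independent, and `H k` is
  exponential with rate `-q_{Y_k Y_k}`. -/
  holding : ∀ (m : ℕ) (y : ℕ → ℕ) (t : ℕ → ℝ≥0),
    μ {ω | (∀ k ≤ m, Y k ω = y k) ∧ ∀ k ≤ m, t k < H k ω} =
      μ {ω | ∀ k ≤ m, Y k ω = y k} *
        ∏ k ∈ Finset.range (m + 1), ENNReal.ofReal (Real.exp (Q (y k) (y k) * (t k : ℝ)))

/-- `X = (X_t)_{t ≥ 0}` is a (continuous-time) Markov process on `{0, 1, 2, …}` with generator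
matrix `Q`, started at `x₀`. This is the definition by embedded chain and holding times, for a
generator `Q` without absorbing states. -/
def IsMarkovProcessFrom {Ω : Type*} [MeasurableSpace Ω] (μ : MeasureTheory.Measure Ω)
    (Q : Matrix ℕ ℕ ℝ) (x₀ : ℕ) (X : ℝ≥0 → Ω → ℕ) : Prop :=
  (∀ t, Measurable (X t)) ∧
    ∃ (Y : ℕ → Ω → ℕ) (H : ℕ → Ω → ℝ≥0), IsJumpDescription μ Q x₀ X Y H

/-- The occupation time `l_{T_n}^i`: the Lebesgue measure of the set of times `t < T_n` with
`X_t = i`, where `T_n` is the first time that `X` reaches `n` (`⊤` if it never does). -/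
noncomputable def occupationTime {Ω : Type*} (X : ℝ≥0 → Ω → ℕ) (n i : ℕ) (ω : Ω) : ℝ≥0∞ :=
  MeasureTheory.volume
    ((fun t : ℝ≥0 => (t : ℝ)) ''
      {t | X t ω = i ∧ (t : WithTop ℝ≥0) < MeasureTheory.hittingAfter X {n} 0 ω})

/-- The finite sequence `Z_0, …, Z_{n-1}` of random variables has the Markov property: for every
`k` with `k + 1 ≤ n - 1`, the conditional distribution of `Z_{k+1}` given `(Z_0, …, Z_k)` is its
conditional distribution given `Z_k` alone. No time-homogeneity is required. -/
def HasMarkovProperty {Ω E : Type*} [MeasurableSpace Ω] [MeasurableSpace E]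
    [StandardBorelSpace E] [Nonempty E] (μ : MeasureTheory.Measure Ω)
    [MeasureTheory.IsFiniteMeasure μ] {n : ℕ} (Z : Fin n → Ω → E) : Prop :=
  ∀ (k : ℕ) (hk : k + 1 < n), ∀ᵐ ω ∂μ,
    ProbabilityTheory.condDistrib (Z ⟨k + 1, hk⟩)
        (fun ω' (j : Fin (k + 1)) => Z (j.castLE hk.le) ω') μ
        (fun j : Fin (k + 1) => Z (j.castLE hk.le) ω) =
      ProbabilityTheory.condDistrib (Z ⟨k + 1, hk⟩) (Z ⟨k, Nat.lt_of_succ_lt hk⟩) μ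
        (Z ⟨k, Nat.lt_of_succ_lt hk⟩ ω)

end SkipFree

/-! For killing rates `l ≥ 0` let `h` solve `∑ j, Q i j * h j = l i * h i` with `h 0 = 1`; since `Q
i (i + 1)` is the last nonzero entry of row `i`, the equation is a recursion upwards. Optional
stopping of `h` along the chain killed at rate `l` shows that the joint Laplace transform of the
occupation times before `T_n` is `1 / h n` (`lintegral_exp_occupationTime`).

A nonzero entry off the three central diagonals must lie below them, so `Q (i + 2) j > 0` for some
`j ≤ i`. Kill only at `i`, `i + 1`, `i + 2`, with rates `s`, `t`, `u`. Then `h = 1` up to `i`, and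
linearity gives `h n = (c * u + e) * h (i + 2) + d * h (i + 1) + e'`. The constant `e'` is the
contribution of the value `1` at the states up to `i`, and the long downward jump makes it negative
(`exists_harmonicSolution_threeRates`).

For `s = 0`, `h n` is affine in `t`, and its values for `u = 1` and `u = 0` differ by a factor and a
shift of `t`. Hence the conditional mean of `exp (-V)` given `W` is `A * exp (-γ * W)`, where `W`
and `V` are the occupation times of `i + 1` and `i + 2`. Under the Markov property this survives
conditioning on the occupation time of `i` as well, so the same shift relation holds for `s = 1`.
Comparing the two relations forces `(1 - A) * e' = 0`, although `A < 1` and `e' < 0`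
(`not_condDistrib_occupationTime_eq`). -/

namespace SkipFree

/-! ### The recursion `Q v = l v` and its maximum principle -/

/-- The sequence which agrees with `a` up to the index `k` and then solves
`∑ j, Q i j * v j = l i * v i` for all `i ≥ k`. -/
noncomputable def harmonicExtension (Q : Matrix ℕ ℕ ℝ) (l : ℕ → ℝ) (k : ℕ) (a : ℕ → ℝ) : ℕ → ℝ
  | 0 => a 0
  | i + 1 =>
    if i + 1 ≤ k then a (i + 1)
    else ((l i - Q i i) * harmonicExtension Q l k a i -
      ∑ j : Fin i, Q i j * harmonicExtension Q l k a j) / Q i (i + 1)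
decreasing_by all_goals omega

section HarmonicExtension

variable {Q : Matrix ℕ ℕ ℝ} {l a v : ℕ → ℝ} {k : ℕ}

lemma harmonicExtension_of_le {i : ℕ} (h : i ≤ k) : harmonicExtension Q l k a i = a i := by
  cases i with
  | zero => rw [harmonicExtension]
  | succ i => rw [harmonicExtension, if_pos h]

lemma harmonicExtension_succ (hQ : IsSkipFreeGenerator Q) {i : ℕ} (h : k ≤ i) :
    Q i (i + 1) * harmonicExtension Q l k a (i + 1) =
      (l i - Q i i) * harmonicExtension Q l k a i -
        ∑ j ∈ Finset.range i, Q i j * harmonicExtension Q l k a j := by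
  conv_lhs => rw [harmonicExtension]
  rw [if_neg (by omega), mul_div_cancel₀ _ (hQ.up_pos i).ne', Finset.sum_range]

lemma IsSkipFreeGenerator.diag_eq (hQ : IsSkipFreeGenerator Q) (i : ℕ) :
    -Q i i = Q i (i + 1) + ∑ j ∈ Finset.range i, Q i j := by
  have := hQ.row_sum i
  rw [Finset.sum_range_succ, Finset.sum_range_succ] at this
  linarith

lemma IsSkipFreeGenerator.diag_neg (hQ : IsSkipFreeGenerator Q) (i : ℕ) : Q i i < 0 := by
  have h1 := hQ.diag_eq i
  have h2 : 0 ≤ ∑ j ∈ Finset.range i, Q i j :=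
    Finset.sum_nonneg fun j hj => hQ.nonneg_of_ne i j (by simp at hj; omega)
  linarith [hQ.up_pos i]

/-- A maximum principle: a solution which is monotone up to `k` is monotone. -/
lemma monotone_of_harmonic (hQ : IsSkipFreeGenerator Q)
    (hv : ∀ i, k ≤ i → Q i (i + 1) * v (i + 1) =
      (l i - Q i i) * v i - ∑ j ∈ Finset.range i, Q i j * v j)
    (hk : ∀ i j, i ≤ j → j ≤ k → v i ≤ v j)
    (hl : ∀ i, k ≤ i → (∀ j ≤ i, v j ≤ v i) → 0 ≤ l i * v i) : Monotone v := by
  have main : ∀ m, ∀ i ≤ m, v i ≤ v m := by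
    intro m
    induction m with
    | zero => intro i hi; rw [Nat.le_zero.1 hi]
    | succ m ih =>
      intro i hi
      rcases Nat.lt_or_ge m k with hm | hm
      · exact hk _ _ hi hm
      -- As row `m` sums to zero, `Q m (m + 1) * (v (m + 1) - v m)` equals `l m * v m + ∑ j < m, Q m
      -- j * (v m - v j)`, and every term is nonnegative.
      have hstep : v m ≤ v (m + 1) := by
        have h1 := hv m hm
        have h2 := hl m hm ih
        have h3 := hQ.diag_eq m
        have h4 : ∑ j ∈ Finset.range m, Q m j * v j ≤ (∑ j ∈ Finset.range m, Q m j) * v m := by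
          rw [Finset.sum_mul]
          refine Finset.sum_le_sum fun j hj => ?_
          have hj' := Finset.mem_range.1 hj
          exact mul_le_mul_of_nonneg_left (ih j hj'.le) (hQ.nonneg_of_ne m j (by omega))
        have h5 : ∑ j ∈ Finset.range m, Q m j = -Q m m - Q m (m + 1) := by linarith
        rw [h5] at h4
        refine le_of_mul_le_mul_left ?_ (hQ.up_pos m)
        nlinarith
      rcases Nat.lt_or_ge i (m + 1) with h | h
      · exact (ih i (by omega)).trans hstep
      · rw [show i = m + 1 by omega]
  exact fun i j hij => main j i hij

lemma eq_of_harmonic {w : ℕ → ℝ} (hQ : IsSkipFreeGenerator Q)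
    (hv : ∀ i, k ≤ i → Q i (i + 1) * v (i + 1) =
      (l i - Q i i) * v i - ∑ j ∈ Finset.range i, Q i j * v j)
    (hw : ∀ i, k ≤ i → Q i (i + 1) * w (i + 1) =
      (l i - Q i i) * w i - ∑ j ∈ Finset.range i, Q i j * w j)
    (h : ∀ i ≤ k, v i = w i) (m : ℕ) : v m = w m := by
  induction m using Nat.strong_induction_on with
  | _ m ih =>
    rcases Nat.lt_or_ge k m with hm | hm
    · obtain ⟨i, rfl⟩ : ∃ i, m = i + 1 := ⟨m - 1, by omega⟩
      refine mul_left_cancel₀ (hQ.up_pos i).ne' ?_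
      rw [hv i (by omega), hw i (by omega), ih i (by omega)]
      congr 1
      exact Finset.sum_congr rfl fun j hj => by
        rw [ih j (by have := Finset.mem_range.1 hj; omega)]
    · exact h m hm

end HarmonicExtension

/-- The solution of `∑ j, Q i j * v j = l i * v i`, `v 0 = 1`. -/
noncomputable def harmonicSolution (Q : Matrix ℕ ℕ ℝ) (l : ℕ → ℝ) : ℕ → ℝ :=
  harmonicExtension Q l 0 fun _ => 1

section HarmonicSolution

variable {Q : Matrix ℕ ℕ ℝ} {l : ℕ → ℝ}

@[simp] lemma harmonicSolution_zero : harmonicSolution Q l 0 = 1 :=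
  harmonicExtension_of_le le_rfl

lemma harmonicSolution_succ (hQ : IsSkipFreeGenerator Q) (i : ℕ) :
    Q i (i + 1) * harmonicSolution Q l (i + 1) =
      (l i - Q i i) * harmonicSolution Q l i -
        ∑ j ∈ Finset.range i, Q i j * harmonicSolution Q l j :=
  harmonicExtension_succ hQ (Nat.zero_le i)

/-- The killing term has the right sign because a value that dominates all earlier ones is at least
`v 0 = 1`. -/
lemma monotone_harmonicSolution (hQ : IsSkipFreeGenerator Q) (hl : ∀ i, 0 ≤ l i) :
    Monotone (harmonicSolution Q l) := by
  refine monotone_of_harmonic (k := 0) hQ (fun i _ => harmonicSolution_succ hQ i) ?_ ?_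
  · intro i j hij hj
    rw [show i = j by omega]
  · intro i _ h
    have := h 0 (Nat.zero_le i)
    rw [harmonicSolution_zero] at this
    exact mul_nonneg (hl i) (by linarith)

lemma one_le_harmonicSolution (hQ : IsSkipFreeGenerator Q) (hl : ∀ i, 0 ≤ l i) (i : ℕ) :
    1 ≤ harmonicSolution Q l i := by
  simpa using monotone_harmonicSolution hQ hl (Nat.zero_le i)

/-- Zero row sums make constants solutions until the first state with killing. -/
lemma harmonicSolution_eq_one (hQ : IsSkipFreeGenerator Q) {m : ℕ} (hl : ∀ i < m, l i = 0) :
    harmonicSolution Q l m = 1 := by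
  induction m using Nat.strong_induction_on with
  | _ m ih =>
    cases m with
    | zero => simp
    | succ i =>
      have hj : ∀ j ≤ i, harmonicSolution Q l j = 1 := fun j hj =>
        ih j (by omega) fun p hp => hl p (by omega)
      refine mul_left_cancel₀ (hQ.up_pos i).ne' ?_
      rw [harmonicSolution_succ hQ, hj i le_rfl, hl i (by omega),
        Finset.sum_congr rfl fun j hj' => by rw [hj j (Finset.mem_range.1 hj').le]]
      have := hQ.diag_eq i
      simp only [mul_one]
      linarith

lemma continuous_harmonicSolution_comp {T : Type*} [TopologicalSpace T] (hQ : IsSkipFreeGenerator Q)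
    {g : T → ℕ → ℝ} (hg : ∀ i, Continuous fun x => g x i) (m : ℕ) :
    Continuous fun x => harmonicSolution Q (g x) m := by
  induction m using Nat.strong_induction_on with
  | _ m ih =>
    cases m with
    | zero => simpa using continuous_const
    | succ i =>
      have h : (fun x => harmonicSolution Q (g x) (i + 1)) = fun x =>
          ((g x i - Q i i) * harmonicSolution Q (g x) i -
            ∑ j ∈ Finset.range i, Q i j * harmonicSolution Q (g x) j) / Q i (i + 1) := by
        ext x
        rw [eq_div_iff (hQ.up_pos i).ne', mul_comm, harmonicSolution_succ hQ]
      rw [h]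
      refine Continuous.div_const ?_ _
      refine (((hg i).sub continuous_const).mul (ih i (by omega))).sub ?_
      exact continuous_finsetSum _ fun j hj =>
        continuous_const.mul (ih j (by have := Finset.mem_range.1 hj; omega))

end HarmonicSolution

/-! ### Killing at three consecutive states -/

/-- The killing rates `s`, `t`, `u` at the consecutive states `i`, `i + 1`, `i + 2`. -/
def threeRates (i : ℕ) (s t u : ℝ) (j : ℕ) : ℝ :=
  if j = i then s else if j = i + 1 then t else if j = i + 2 then u else 0

lemma threeRates_nonneg {i : ℕ} {s t u : ℝ} (hs : 0 ≤ s) (ht : 0 ≤ t) (hu : 0 ≤ u) (j : ℕ) :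
    0 ≤ threeRates i s t u j := by
  unfold threeRates; split_ifs <;> first | assumption | exact le_rfl

section ThreeRates

variable {Q : Matrix ℕ ℕ ℝ}

lemma harmonicSolution_threeRates_one (hQ : IsSkipFreeGenerator Q) (i : ℕ) (s t u : ℝ) :
    harmonicSolution Q (threeRates i s t u) (i + 1) = 1 + s / Q i (i + 1) := by
  have hone : ∀ j ≤ i, harmonicSolution Q (threeRates i s t u) j = 1 := fun j hj =>
    harmonicSolution_eq_one hQ fun p hp => by
      unfold threeRates; rw [if_neg, if_neg, if_neg] <;> omega
  have hp := hQ.up_pos i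
  have h := harmonicSolution_succ (l := threeRates i s t u) hQ i
  rw [hone i le_rfl, Finset.sum_congr rfl fun j hj' => by
    rw [hone j (Finset.mem_range.1 hj').le]] at h
  have h2 := hQ.diag_eq i
  have h3 : threeRates i s t u i = s := by simp [threeRates]
  rw [h3] at h
  simp only [mul_one] at h
  field_simp
  linarith

lemma harmonicSolution_threeRates_two (hQ : IsSkipFreeGenerator Q) (i : ℕ) (s t u : ℝ) :
    harmonicSolution Q (threeRates i s t u) (i + 2) =
      ((t - Q (i + 1) (i + 1)) * (1 + s / Q i (i + 1)) +
        Q (i + 1) (i + 1) + Q (i + 1) (i + 2)) / Q (i + 1) (i + 2) := by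
  have hone : ∀ j ≤ i, harmonicSolution Q (threeRates i s t u) j = 1 := fun j hj =>
    harmonicSolution_eq_one hQ fun p hp => by
      unfold threeRates; rw [if_neg, if_neg, if_neg] <;> omega
  have hp := hQ.up_pos (i + 1)
  have h := harmonicSolution_succ (l := threeRates i s t u) hQ (i + 1)
  rw [harmonicSolution_threeRates_one hQ, Finset.sum_congr rfl fun j hj' => by
    rw [hone j (Nat.lt_succ_iff.1 (Finset.mem_range.1 hj'))]] at h
  have h2 := hQ.diag_eq (i + 1)
  have h3 : threeRates i s t u (i + 1) = t := by simp [threeRates]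
  rw [h3] at h
  simp only [mul_one] at h
  rw [eq_div_iff hp.ne']
  linarith

/-- The harmonic solution with killing at the states `i`, `i + 1`, `i + 2` in terms of its values
at `i + 1` and `i + 2`. -/
lemma exists_harmonicSolution_threeRates (hQ : IsSkipFreeGenerator Q) {i n : ℕ} (hn : i + 2 < n)
    (hi : ∃ j ≤ i, 0 < Q (i + 2) j) :
    ∃ c e d e' : ℝ, 0 < c ∧ 1 ≤ e ∧ e' < 0 ∧ e + d + e' = 1 ∧ ∀ s t u : ℝ,
      harmonicSolution Q (threeRates i s t u) n =
        (c * u + e) * harmonicSolution Q (threeRates i s t u) (i + 2) +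
          d * harmonicSolution Q (threeRates i s t u) (i + 1) + e' := by
  -- Fundamental solutions without killing. `E`, `D`, `E'` propagate the value at `i + 2`, the value
  -- at `i + 1`, and the common value `1` at the states up to `i`. They omit the killing at `i + 2`,
  -- which adds `u * h (i + 2) / Q (i + 2) (i + 3)` to the value at `i + 3`; `C` propagates this
  -- source, so its recursion starts one row later.
  set C := harmonicExtension Q 0 (i + 3) fun j => if j = i + 3 then (Q (i + 2) (i + 3))⁻¹ else 0
    with hC
  set E := harmonicExtension Q 0 (i + 2) fun j => if j = i + 2 then 1 else 0 with hE
  set D := harmonicExtension Q 0 (i + 2) fun j => if j = i + 1 then 1 else 0 with hD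
  set E' := harmonicExtension Q 0 (i + 2) fun j => if j ≤ i then 1 else 0 with hE'
  have hq := hQ.up_pos (i + 2)
  have key : ∀ s t u m, harmonicSolution Q (threeRates i s t u) m =
        (C m * u + E m) * harmonicSolution Q (threeRates i s t u) (i + 2) +
          D m * harmonicSolution Q (threeRates i s t u) (i + 1) + E' m := by
    intro s t u
    set h := harmonicSolution Q (threeRates i s t u) with hh
    have hone : ∀ j ≤ i, h j = 1 := fun j hj =>
      harmonicSolution_eq_one hQ fun p hp => by
        unfold threeRates; rw [if_neg, if_neg, if_neg] <;> omega
    have hle : ∀ m ≤ i + 2, h m = (C m * u + E m) * h (i + 2) + D m * h (i + 1) + E' m := by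
      intro m hm
      rw [hC, hE, hD, hE', harmonicExtension_of_le (by omega), harmonicExtension_of_le hm,
        harmonicExtension_of_le hm, harmonicExtension_of_le hm, if_neg (by omega)]
      rcases Nat.lt_or_ge i m with h1 | h1
      · obtain rfl | rfl : m = i + 1 ∨ m = i + 2 := by omega
        · simp
        · simp
      · rw [if_neg (by omega), if_neg (by omega), if_pos h1, hone m h1]; simp
    -- From row `i + 3` on there is no killing and both sides solve the same recursion; the rate `u`
    -- enters only through row `i + 2`, in the check of the value at `i + 3`.
    refine eq_of_harmonic (k := i + 3) (l := threeRates i s t u) hQ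
      (fun m _ => harmonicSolution_succ hQ m) ?_ ?_
    · intro m hm
      have h0 : threeRates i s t u m = 0 := by
        unfold threeRates; rw [if_neg, if_neg, if_neg] <;> omega
      have hc := harmonicExtension_succ (l := 0) (k := i + 3)
        (a := fun j => if j = i + 3 then (Q (i + 2) (i + 3))⁻¹ else 0) hQ hm
      have he := harmonicExtension_succ (l := 0) (k := i + 2)
        (a := fun j => if j = i + 2 then 1 else 0) hQ (i := m) (by omega)
      have hd := harmonicExtension_succ (l := 0) (k := i + 2)
        (a := fun j => if j = i + 1 then 1 else 0) hQ (i := m) (by omega)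
      have he' := harmonicExtension_succ (l := 0) (k := i + 2)
        (a := fun j => if j ≤ i then 1 else 0) hQ (i := m) (by omega)
      rw [← hC] at hc
      rw [← hE] at he
      rw [← hD] at hd
      rw [← hE'] at he'
      simp only [Pi.zero_apply, zero_sub] at hc he hd he'
      have hsum : ∑ j ∈ Finset.range m,
            Q m j * ((C j * u + E j) * h (i + 2) + D j * h (i + 1) + E' j) =
          (u * ∑ j ∈ Finset.range m, Q m j * C j + ∑ j ∈ Finset.range m, Q m j * E j) * h (i + 2) +
            (∑ j ∈ Finset.range m, Q m j * D j) * h (i + 1) +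
            ∑ j ∈ Finset.range m, Q m j * E' j := by
        simp only [Finset.mul_sum, Finset.sum_mul, add_mul, ← Finset.sum_add_distrib]
        exact Finset.sum_congr rfl fun j _ => by ring
      rw [hsum, h0]
      linear_combination (u * h (i + 2)) * hc + h (i + 2) * he + h (i + 1) * hd + he'
    · intro m hm
      rcases Nat.lt_or_ge (i + 2) m with h1 | h1
      · obtain rfl : m = i + 2 + 1 := by omega
        refine mul_left_cancel₀ hq.ne' ?_
        have hc : C (i + 2 + 1) = (Q (i + 2) (i + 3))⁻¹ := by
          rw [hC, harmonicExtension_of_le le_rfl, if_pos rfl]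
        have he := harmonicExtension_succ (l := 0) (k := i + 2)
          (a := fun j => if j = i + 2 then 1 else 0) hQ le_rfl
        have hd := harmonicExtension_succ (l := 0) (k := i + 2)
          (a := fun j => if j = i + 1 then 1 else 0) hQ le_rfl
        have he' := harmonicExtension_succ (l := 0) (k := i + 2)
          (a := fun j => if j ≤ i then 1 else 0) hQ le_rfl
        rw [← hE] at he
        rw [← hD] at hd
        rw [← hE'] at he'
        simp only [Pi.zero_apply, zero_sub] at he hd he'
        have hcj : ∀ j ≤ i + 2, C j = 0 := fun j hj => by
          rw [hC, harmonicExtension_of_le (by omega), if_neg (by omega)]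
        have h2 := harmonicSolution_succ (l := threeRates i s t u) hQ (i + 2)
        rw [← hh] at h2
        have h3 : threeRates i s t u (i + 2) = u := by simp [threeRates]
        have hsum : ∑ j ∈ Finset.range (i + 2), Q (i + 2) j * h j =
            (∑ j ∈ Finset.range (i + 2), Q (i + 2) j * E j) * h (i + 2) +
            (∑ j ∈ Finset.range (i + 2), Q (i + 2) j * D j) * h (i + 1) +
            ∑ j ∈ Finset.range (i + 2), Q (i + 2) j * E' j := by
          simp only [Finset.sum_mul, ← Finset.sum_add_distrib]
          refine Finset.sum_congr rfl fun j hj => ?_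
          have hj' := (Finset.mem_range.1 hj).le
          rw [hle j hj', hcj j hj']
          ring
        have hE2 : E (i + 2) = 1 := by rw [hE, harmonicExtension_of_le le_rfl, if_pos rfl]
        have hD2 : D (i + 2) = 0 := by
          rw [hD, harmonicExtension_of_le le_rfl, if_neg (by omega)]
        have hE2' : E' (i + 2) = 0 := by
          rw [hE', harmonicExtension_of_le le_rfl, if_neg (by omega)]
        rw [hE2] at he
        rw [hD2] at hd
        rw [hE2'] at he'
        rw [hsum, h3] at h2
        have hcc : Q (i + 2) (i + 2 + 1) * C (i + 2 + 1) = 1 := by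
          rw [hc]; exact mul_inv_cancel₀ hq.ne'
        linear_combination h2 - h (i + 2) * he - h (i + 1) * hd - he' - (u * h (i + 2)) * hcc
      · exact hle m h1
  have hCm : Monotone C := by
    refine monotone_of_harmonic (l := 0) (k := i + 3) hQ
      (fun m hm => harmonicExtension_succ hQ hm) ?_ (by simp)
    intro a b hab hb
    rw [hC, harmonicExtension_of_le (hab.trans hb), harmonicExtension_of_le hb]
    have := inv_pos.2 hq
    split_ifs <;> first | omega | exact le_rfl | exact this.le
  have hEm : Monotone E := by
    refine monotone_of_harmonic (l := 0) (k := i + 2) hQ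
      (fun m hm => harmonicExtension_succ hQ hm) ?_ (by simp)
    intro a b hab hb
    rw [hE, harmonicExtension_of_le (hab.trans hb), harmonicExtension_of_le hb]
    split_ifs <;> first | omega | norm_num
  have hEm' : Monotone fun m => -E' m := by
    refine monotone_of_harmonic (l := 0) (k := i + 2) hQ ?_ ?_ (by simp)
    · intro m hm
      have := harmonicExtension_succ (l := 0) (k := i + 2)
          (a := fun j => if j ≤ i then 1 else 0) hQ hm
      rw [← hE'] at this
      simp only [mul_neg, Finset.sum_neg_distrib]
      linarith
    intro a b hab hb
    rw [hE', harmonicExtension_of_le (hab.trans hb), harmonicExtension_of_le hb]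
    split_ifs <;> first | omega | norm_num
  refine ⟨C n, E n, D n, E' n, ?_, ?_, ?_, ?_, fun s t u => key s t u n⟩
  · refine lt_of_lt_of_le ?_ (hCm (show i + 3 ≤ n from hn))
    rw [hC, harmonicExtension_of_le le_rfl, if_pos rfl]
    exact inv_pos.2 hq
  · refine le_trans ?_ (hEm hn.le)
    rw [hE, harmonicExtension_of_le le_rfl, if_pos rfl]
  -- Row `i + 2` gives `E' (i + 3) = -(∑ j ≤ i, Q (i + 2) j) / Q (i + 2) (i + 3)`, which is negative
  -- by the long downward jump; monotonicity of `-E'` carries this to `n`.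
  · refine lt_of_le_of_lt (neg_le_neg_iff.1 (hEm' (show i + 2 + 1 ≤ n from hn))) ?_
    have he' := harmonicExtension_succ (l := 0) (k := i + 2)
          (a := fun j => if j ≤ i then 1 else 0) hQ le_rfl
    rw [← hE', Finset.sum_range_succ] at he'
    have h1 : E' (i + 2) = 0 := by
      rw [hE', harmonicExtension_of_le le_rfl, if_neg (by omega)]
    have h2 : E' (i + 1) = 0 := by
      rw [hE', harmonicExtension_of_le (by omega), if_neg (by omega)]
    have h3 : 0 < ∑ j ∈ Finset.range (i + 1), Q (i + 2) j * E' j := by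
      have hval : ∀ j ∈ Finset.range (i + 1), Q (i + 2) j * E' j = Q (i + 2) j := by
        intro j hj
        have := Finset.mem_range.1 hj
        rw [hE', harmonicExtension_of_le (by omega), if_pos (by omega), mul_one]
      rw [Finset.sum_congr rfl hval]
      obtain ⟨j, hj, hpos⟩ := hi
      refine Finset.sum_pos' (fun p hp => hQ.nonneg_of_ne _ _ ?_)
        ⟨j, Finset.mem_range.2 (by omega), hpos⟩
      have := Finset.mem_range.1 hp
      omega
    rw [h1, h2] at he'
    by_contra hcon
    push Not at hcon
    nlinarith [mul_nonneg hq.le hcon]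
  -- Without killing the solution is constantly `1`.
  · have h := key 0 0 0 n
    have h0 : threeRates i 0 0 0 = fun _ => 0 := by
      ext j; unfold threeRates; simp
    rw [h0, harmonicSolution_eq_one hQ (by simp), harmonicSolution_eq_one hQ (by simp),
      harmonicSolution_eq_one hQ (by simp)] at h
    linarith

end ThreeRates

end SkipFree

/-! ### Laplace transforms of exponential variables from their tails -/

namespace SkipFree
open MeasureTheory

section ExponentialTails

variable {Ω : Type*} [MeasurableSpace Ω]

lemma lintegral_Ioi_exp_neg {a : ℝ} (ha : 0 < a) :
    ∫⁻ t in Set.Ioi (0 : ℝ), ENNReal.ofReal (Real.exp (-a * t)) = ENNReal.ofReal a⁻¹ := by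
  rw [← ofReal_integral_eq_lintegral_ofReal
    (integrableOn_exp_mul_Ioi (neg_lt_zero.2 ha) 0)
    (Filter.Eventually.of_forall fun t => (Real.exp_pos _).le),
    integral_exp_mul_Ioi (neg_lt_zero.2 ha)]
  congr 1
  simp [neg_div]

/-- The Laplace transform of an exponentially distributed variable, from its tails. -/
lemma lintegral_exp_neg_of_tail {ν : Measure Ω} {H : Ω → ℝ≥0} (hH : Measurable H)
    (hpos : ∀ᵐ ω ∂ν, 0 < H ω) {C : ℝ≥0∞} (hC : C ≠ ∞) {r l : ℝ} (hr : 0 < r) (hl : 0 ≤ l)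
    (htail : ∀ t : ℝ≥0, ν {ω | t < H ω} = C * ENNReal.ofReal (Real.exp (-r * t))) :
    ∫⁻ ω, ENNReal.ofReal (Real.exp (-l * H ω)) ∂ν = C * ENNReal.ofReal (r / (r + l)) := by
  have huniv : ν Set.univ = C := by
    have h := htail 0
    simp only [NNReal.coe_zero, mul_zero, Real.exp_zero, ENNReal.ofReal_one, mul_one] at h
    rw [← h]
    refine measure_congr ?_
    filter_upwards [hpos] with ω hω
    exact (eq_true (show ω ∈ {ω | 0 < H ω} from hω)).symm
  -- Layer cake formula for `1 - exp (-l * H) = ∫ t in 0..H, l * exp (-l * t)`; the transform is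
  -- then obtained by subtraction from the total mass `C`.
  have hlayer := lintegral_comp_eq_lintegral_meas_lt_mul ν (f := fun ω => (H ω : ℝ))
    (g := fun t => l * Real.exp (-l * t)) (Filter.Eventually.of_forall fun ω => (H ω).2)
    hH.coe_nnreal_real.aemeasurable
    (fun t _ => (Continuous.intervalIntegrable (by fun_prop) _ _))
    (Filter.Eventually.of_forall fun t => mul_nonneg hl (Real.exp_pos _).le)
  have hprim : ∀ x : ℝ, ∫ t in (0 : ℝ)..x, l * Real.exp (-l * t) = 1 - Real.exp (-l * x) := by
    intro x
    rw [intervalIntegral.integral_eq_sub_of_hasDerivAt (f := fun t => -Real.exp (-l * t))]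
    · simp; ring
    · intro t _
      have h := (((hasDerivAt_id t).const_mul (-l)).exp.neg)
      rw [show l * Real.exp (-l * t) = -(Real.exp (-l * t) * (-l * 1)) by ring]
      exact h
    · exact Continuous.intervalIntegrable (by fun_prop) _ _
  simp only [hprim] at hlayer
  have hright : ∫⁻ t in Set.Ioi (0 : ℝ), ν {ω | t < (H ω : ℝ)} *
      ENNReal.ofReal (l * Real.exp (-l * t)) = C * ENNReal.ofReal (l / (r + l)) := by
    have : ∀ t ∈ Set.Ioi (0 : ℝ), ν {ω | t < (H ω : ℝ)} * ENNReal.ofReal (l * Real.exp (-l * t)) =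
        C * (ENNReal.ofReal l * ENNReal.ofReal (Real.exp (-(r + l) * t))) := by
      intro t ht
      lift t to ℝ≥0 using le_of_lt ht
      simp only [NNReal.coe_lt_coe]
      rw [htail t, mul_assoc, ← ENNReal.ofReal_mul (Real.exp_pos _).le, ← ENNReal.ofReal_mul hl]
      congr 2
      rw [mul_left_comm, ← Real.exp_add]
      congr 2
      ring
    rw [setLIntegral_congr_fun measurableSet_Ioi this, lintegral_const_mul' _ _ hC,
      lintegral_const_mul' _ _ ENNReal.ofReal_ne_top, lintegral_Ioi_exp_neg (by positivity),
      ← ENNReal.ofReal_mul hl, div_eq_mul_inv]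
  rw [hright] at hlayer
  have hsum : ∫⁻ ω, ENNReal.ofReal (Real.exp (-l * H ω)) ∂ν +
      ∫⁻ ω, ENNReal.ofReal (1 - Real.exp (-l * H ω)) ∂ν = C := by
    rw [← lintegral_add_left (by fun_prop), ← huniv, ← lintegral_one]
    refine lintegral_congr fun ω => ?_
    have h1 : Real.exp (-l * H ω) ≤ 1 := Real.exp_le_one_iff.2 (by
      rw [neg_mul, neg_nonpos]; exact mul_nonneg hl (H ω).2)
    rw [← ENNReal.ofReal_add (Real.exp_pos _).le (by linarith)]
    simp
  rw [hlayer] at hsum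
  have hsum' : C * ENNReal.ofReal (r / (r + l)) + C * ENNReal.ofReal (l / (r + l)) = C := by
    rw [← mul_add, ← ENNReal.ofReal_add (by positivity) (by positivity), ← add_div,
      div_self (by positivity), ENNReal.ofReal_one, mul_one]
  exact (ENNReal.add_left_inj (ENNReal.mul_ne_top hC ENNReal.ofReal_ne_top)).1
    (hsum.trans hsum'.symm)

/-- The joint Laplace transform of independent exponentially distributed variables, from their
joint tails. -/
lemma lintegral_prod_exp_neg_of_tail {H : ℕ → Ω → ℝ≥0} (hH : ∀ k, Measurable (H k))
    {r l : ℕ → ℝ} (hr : ∀ k, 0 < r k) (hl : ∀ k, 0 ≤ l k) (s : Finset ℕ) {ν : Measure Ω}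
    (hpos : ∀ k ∈ s, ∀ᵐ ω ∂ν, 0 < H k ω) {C : ℝ≥0∞} (hC : C ≠ ∞)
    (htail : ∀ t : ℕ → ℝ≥0, ν {ω | ∀ k ∈ s, t k < H k ω} =
      C * ∏ k ∈ s, ENNReal.ofReal (Real.exp (-r k * t k))) :
    ∫⁻ ω, ∏ k ∈ s, ENNReal.ofReal (Real.exp (-l k * H k ω)) ∂ν =
      C * ∏ k ∈ s, ENNReal.ofReal (r k / (r k + l k)) := by
  induction s using Finset.induction_on generalizing ν C with
  | empty => simpa using htail 0
  | insert a s ha ih =>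
    have hmeas : Measurable fun ω => ENNReal.ofReal (Real.exp (-l a * H a ω)) := by fun_prop
    -- The factor of index `a` is absorbed into the measure as a density: the remaining variables
    -- keep their product tails, and only the total mass changes.
    have hrest : ∀ t : ℕ → ℝ≥0,
        (ν.withDensity fun ω => ENNReal.ofReal (Real.exp (-l a * H a ω)))
          {ω | ∀ k ∈ s, t k < H k ω} = C * ENNReal.ofReal (r a / (r a + l a)) *
            ∏ k ∈ s, ENNReal.ofReal (Real.exp (-r k * t k)) := by
      intro t
      have hA : MeasurableSet {ω | ∀ k ∈ s, t k < H k ω} := by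
        have : {ω | ∀ k ∈ s, t k < H k ω} = ⋂ k ∈ s, {ω | t k < H k ω} := by ext; simp
        rw [this]
        exact Finset.measurableSet_biInter s fun k _ => measurableSet_lt measurable_const (hH k)
      rw [withDensity_apply _ hA, lintegral_exp_neg_of_tail (hH a)
        (ae_restrict_of_ae (hpos a (Finset.mem_insert_self a s)))
        (C := C * ∏ k ∈ s, ENNReal.ofReal (Real.exp (-r k * t k)))
        (ENNReal.mul_ne_top hC (ENNReal.prod_ne_top fun _ _ => ENNReal.ofReal_ne_top)) (hr a) (hl a)]
      · ring
      · intro x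
        rw [Measure.restrict_apply (measurableSet_lt measurable_const (hH a))]
        have h := htail (Function.update t a x)
        have hset : {ω | ∀ k ∈ insert a s, Function.update t a x k < H k ω} =
            {ω | x < H a ω} ∩ {ω | ∀ k ∈ s, t k < H k ω} := by
          ext ω
          simp only [Finset.mem_insert, forall_eq_or_imp, Function.update_self, Set.mem_ofPred_eq,
            Set.mem_inter_iff]
          refine and_congr_right fun _ => forall₂_congr fun k hk => ?_
          rw [Function.update_of_ne (ne_of_mem_of_not_mem hk ha)]
        rw [hset, Finset.prod_insert ha, Function.update_self] at h
        have hprod : ∏ k ∈ s, ENNReal.ofReal (Real.exp (-r k * Function.update t a x k)) =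
            ∏ k ∈ s, ENNReal.ofReal (Real.exp (-r k * t k)) :=
          Finset.prod_congr rfl fun k hk => by
            rw [Function.update_of_ne (ne_of_mem_of_not_mem hk ha)]
        rw [h, hprod]
        ring
    have h := ih (fun k hk => (withDensity_absolutelyContinuous _ _).ae_le
      (hpos k (Finset.mem_insert_of_mem hk))) (ENNReal.mul_ne_top hC ENNReal.ofReal_ne_top) hrest
    rw [lintegral_withDensity_eq_lintegral_mul _ hmeas
      (Finset.measurable_prod _ fun k _ => by have := hH k; fun_prop)] at h
    simp only [Pi.mul_apply] at h
    simp only [Finset.prod_insert ha]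
    rw [h]
    ring

end ExponentialTails

end SkipFree

/-! ### The embedded chain weighted by its holding times -/

namespace SkipFree
open MeasureTheory

lemma IsSkipFreeGenerator.jumpProb_nonneg {Q : Matrix ℕ ℕ ℝ} (hQ : IsSkipFreeGenerator Q)
    (x y : ℕ) : 0 ≤ jumpProb Q x y := by
  unfold jumpProb
  split_ifs with h
  · exact le_rfl
  · rw [neg_div, ← div_neg]
    exact div_nonneg (hQ.nonneg_of_ne x y h) (by linarith [hQ.diag_neg x])

/-- The mean of `f` after one step of the embedded chain. -/
lemma IsSkipFreeGenerator.tsum_jumpProb {Q : Matrix ℕ ℕ ℝ} (hQ : IsSkipFreeGenerator Q) (x : ℕ)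
    {f : ℕ → ℝ} (hf : ∀ y, 0 ≤ f y) :
    ∑' y, ENNReal.ofReal (jumpProb Q x y) * ENNReal.ofReal (f y) =
      ENNReal.ofReal ((Q x (x + 1) * f (x + 1) + ∑ y ∈ Finset.range x, Q x y * f y) / -Q x x) := by
  rw [tsum_eq_sum (s := Finset.range (x + 2))]
  · rw [Finset.sum_congr rfl fun y _ => (ENNReal.ofReal_mul (hQ.jumpProb_nonneg x y)).symm,
      ← ENNReal.ofReal_sum_of_nonneg fun y _ => mul_nonneg (hQ.jumpProb_nonneg x y) (hf y)]
    congr 1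
    rw [Finset.sum_range_succ, Finset.sum_range_succ, add_div, Finset.sum_div]
    have h1 : jumpProb Q x x = 0 := by simp [jumpProb]
    have h2 : jumpProb Q x (x + 1) = Q x (x + 1) / -Q x x := by
      rw [jumpProb, if_neg (by omega), neg_div, div_neg]
    have h3 : ∀ y ∈ Finset.range x, jumpProb Q x y * f y = Q x y * f y / -Q x x := by
      intro y hy
      rw [jumpProb, if_neg (by have := Finset.mem_range.1 hy; omega), neg_div, div_neg]
      ring
    rw [h1, h2, Finset.sum_congr rfl h3]
    ring
  · intro y hy
    rw [Finset.mem_range] at hy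
    rw [jumpProb, if_neg (by omega), hQ.skip_free x y (by omega)]
    simp

section PathSums

variable {Ω : Type*} [MeasurableSpace Ω] {μ : Measure Ω} {Q : Matrix ℕ ℕ ℝ} {x₀ : ℕ}
  {X : ℝ≥0 → Ω → ℕ} {Y : ℕ → Ω → ℕ} {H : ℕ → Ω → ℝ≥0}

lemma measurableSet_path (hY : ∀ k, Measurable (Y k)) (m : ℕ) (y : ℕ → ℕ) :
    MeasurableSet {ω | ∀ k ≤ m, Y k ω = y k} := by
  have : {ω | ∀ k ≤ m, Y k ω = y k} = ⋂ k ∈ Finset.range (m + 1), Y k ⁻¹' {y k} := by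
    ext; simp
  rw [this]
  exact Finset.measurableSet_biInter _ fun k _ => hY k (measurableSet_singleton _)

/-- Decomposition of an integral along the first states of the chain. -/
lemma lintegral_eq_tsum_path (hY : ∀ k, Measurable (Y k)) (m : ℕ) (f : Ω → ℝ≥0∞) :
    ∫⁻ ω, f ω ∂μ = ∑' y : Fin (m + 1) → ℕ,
      ∫⁻ ω in {ω | ∀ k ≤ m, Y k ω = if h : k < m + 1 then y ⟨k, h⟩ else 0}, f ω ∂μ := by
  rw [← lintegral_iUnion (fun y => measurableSet_path hY m _)]
  · rw [Set.eq_univ_of_forall (s := ⋃ y : Fin (m + 1) → ℕ, _), Measure.restrict_univ]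
    intro ω
    refine Set.mem_iUnion.2 ⟨fun k => Y k ω, fun k hk => ?_⟩
    rw [dif_pos (by omega)]
  · intro y y' hne
    refine Set.disjoint_left.2 fun ω h h' => hne ?_
    ext k
    have h1 := h k (Nat.lt_succ_iff.1 k.2)
    have h2 := h' k (Nat.lt_succ_iff.1 k.2)
    rw [dif_pos k.2] at h1 h2
    exact h1.symm.trans h2

/-- By the tail formula at `t = 0`, each path event has the same measure as its part where the
holding times are positive, and there are only countably many paths of a given length. -/
lemma IsJumpDescription.ae_holding_pos (hJ : IsJumpDescription μ Q x₀ X Y H)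
    [IsProbabilityMeasure μ] : ∀ᵐ ω ∂μ, ∀ k, 0 < H k ω := by
  refine ae_all_iff.2 fun m => ?_
  rw [ae_iff]
  change μ {ω | 0 < H m ω}ᶜ = 0
  rw [← lintegral_indicator_one (measurableSet_lt measurable_const
    (hJ.measurable_holding m)).compl, lintegral_eq_tsum_path hJ.measurable_state m,
    ENNReal.tsum_eq_zero]
  intro y
  set z : ℕ → ℕ := fun k => if h : k < m + 1 then y ⟨k, h⟩ else 0
  have h := hJ.holding m z 0
  simp only [Pi.zero_apply, NNReal.coe_zero, mul_zero, Real.exp_zero, ENNReal.ofReal_one,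
    Finset.prod_const_one, mul_one] at h
  rw [lintegral_indicator_one (measurableSet_lt measurable_const
    (hJ.measurable_holding m)).compl, Measure.restrict_apply (measurableSet_lt measurable_const
    (hJ.measurable_holding m)).compl]
  have hdiff : μ ({ω | ∀ k ≤ m, Y k ω = z k} \
      {ω | (∀ k ≤ m, Y k ω = z k) ∧ ∀ k ≤ m, 0 < H k ω}) = 0 := by
    have hmeas : MeasurableSet {ω | (∀ k ≤ m, Y k ω = z k) ∧ ∀ k ≤ m, 0 < H k ω} := by
      refine (measurableSet_path hJ.measurable_state m z).inter ?_
      have : {ω | ∀ k ≤ m, 0 < H k ω} = ⋂ k ∈ Finset.range (m + 1), {ω | 0 < H k ω} := by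
        ext; simp
      change MeasurableSet {ω | ∀ k ≤ m, 0 < H k ω}
      rw [this]
      exact Finset.measurableSet_biInter _ fun k _ =>
        measurableSet_lt measurable_const (hJ.measurable_holding k)
    have hsub : {ω | (∀ k ≤ m, Y k ω = z k) ∧ ∀ k ≤ m, 0 < H k ω} ⊆ {ω | ∀ k ≤ m, Y k ω = z k} :=
      fun ω hω => hω.1
    rw [measure_sdiff hsub hmeas.nullMeasurableSet (measure_ne_top _ _), h,
      tsub_self]
  refine measure_mono_null (fun ω hω => ?_) hdiff
  exact ⟨hω.2, fun hcon => hω.1 (hcon.2 m le_rfl)⟩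

/-- The weight `∏ k < m, exp (-l (Y k) * H k)` of a path which is killed outside `{0, …, n - 1}`. -/
noncomputable def pathWeight (l : ℕ → ℝ) (n : ℕ) (Y : ℕ → Ω → ℕ) (H : ℕ → Ω → ℝ≥0) (m : ℕ)
    (ω : Ω) : ℝ≥0∞ :=
  ∏ k ∈ Finset.range m,
    if Y k ω < n then ENNReal.ofReal (Real.exp (-l (Y k ω) * H k ω)) else 0

lemma measurable_pathWeight (hJ : IsJumpDescription μ Q x₀ X Y H) (l : ℕ → ℝ) (n m : ℕ) :
    Measurable (pathWeight l n Y H m) := by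
  refine Finset.measurable_prod _ fun k _ => ?_
  have h1 := hJ.measurable_state k
  have h2 := hJ.measurable_holding k
  have h3 : Measurable fun ω => l (Y k ω) := (measurable_from_top (f := l)).comp h1
  exact Measurable.ite (h1 (measurableSet_Iio (a := n))) (by fun_prop) measurable_const

/-- On a fixed path the holding times are independent exponentials, so each factor of the weight
integrates to `r / (r + l)`. The holding times of index `m` to `p` are included with killing rate
`0`, so that the joint tails up to `p` apply. -/
lemma setLIntegral_pathWeight (hQ : IsSkipFreeGenerator Q) (hJ : IsJumpDescription μ Q x₀ X Y H)
    [IsProbabilityMeasure μ] {l : ℕ → ℝ} (hl : ∀ i, 0 ≤ l i) (n m p : ℕ) (hp : m ≤ p + 1)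
    (y : ℕ → ℕ) :
    ∫⁻ ω in {ω | ∀ k ≤ p, Y k ω = y k}, pathWeight l n Y H m ω ∂μ =
      μ {ω | ∀ k ≤ p, Y k ω = y k} * ∏ k ∈ Finset.range m,
        if y k < n then ENNReal.ofReal (-Q (y k) (y k) / (-Q (y k) (y k) + l (y k))) else 0 := by
  have hB := measurableSet_path hJ.measurable_state p y
  have hcongr : ∀ ω ∈ {ω | ∀ k ≤ p, Y k ω = y k}, pathWeight l n Y H m ω =
      (∏ k ∈ Finset.range m, if y k < n then 1 else 0) *
        ∏ k ∈ Finset.range (p + 1),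
          ENNReal.ofReal (Real.exp (-(if k < m then l (y k) else 0) * H k ω)) := by
    intro ω hω
    rw [← Finset.prod_subset (Finset.range_subset_range.2 hp), ← Finset.prod_mul_distrib]
    · refine Finset.prod_congr rfl fun k hk => ?_
      have hk' := Finset.mem_range.1 hk
      rw [hω k (by omega), if_pos hk']
      split_ifs <;> simp
    · intro k _ hk
      rw [Finset.mem_range] at hk
      rw [if_neg hk]
      simp
  rw [setLIntegral_congr_fun hB hcongr, lintegral_const_mul _ (Finset.measurable_prod _ fun k _ => by
    have := hJ.measurable_holding k; fun_prop),
    lintegral_prod_exp_neg_of_tail hJ.measurable_holding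
      (r := fun k => -Q (y k) (y k)) (l := fun k => if k < m then l (y k) else 0)
      (fun k => neg_pos.2 (hQ.diag_neg _)) (fun k => by split_ifs; exacts [hl _, le_rfl])
      (Finset.range (p + 1)) (C := μ {ω | ∀ k ≤ p, Y k ω = y k}) _ (measure_ne_top _ _)]
  · rw [mul_left_comm]
    congr 1
    rw [← Finset.prod_subset (Finset.range_subset_range.2 hp), ← Finset.prod_mul_distrib]
    · refine Finset.prod_congr rfl fun k hk => ?_
      rw [if_pos (Finset.mem_range.1 hk)]
      split_ifs <;> simp
    · intro k _ hk
      rw [Finset.mem_range] at hk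
      rw [if_neg hk, add_zero, div_self (neg_pos.2 (hQ.diag_neg _)).ne', ENNReal.ofReal_one]
  · intro t
    have h := hJ.holding p y t
    simp only [neg_neg]
    rw [← h, Measure.restrict_apply' hB]
    congr 1
    ext ω
    simp only [Finset.mem_range, Nat.lt_succ_iff, Set.mem_inter_iff, Set.mem_ofPred_eq]
    exact and_comm
  · intro k _
    exact ae_restrict_of_ae (hJ.ae_holding_pos.mono fun ω h => h k)

/-- The Markov property of the embedded chain with holding times, in terms of path weights. -/
lemma lintegral_pathWeight_succ (hQ : IsSkipFreeGenerator Q)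
    (hJ : IsJumpDescription μ Q x₀ X Y H) [IsProbabilityMeasure μ] {l : ℕ → ℝ}
    (hl : ∀ i, 0 ≤ l i) (n m : ℕ) (f : ℕ → ℝ≥0∞) :
    ∫⁻ ω, pathWeight l n Y H (m + 1) ω * f (Y (m + 1) ω) ∂μ =
      ∫⁻ ω, pathWeight l n Y H m ω *
        (if Y m ω < n then ENNReal.ofReal (-Q (Y m ω) (Y m ω) / (-Q (Y m ω) (Y m ω) + l (Y m ω))) *
          ∑' z, ENNReal.ofReal (jumpProb Q (Y m ω) z) * f z else 0) ∂μ := by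
  rw [lintegral_eq_tsum_path hJ.measurable_state m, lintegral_eq_tsum_path hJ.measurable_state m
    (fun ω => pathWeight l n Y H m ω * _)]
  refine tsum_congr fun y => ?_
  set x : ℕ → ℕ := fun k => if h : k < m + 1 then y ⟨k, h⟩ else 0
  have hB := measurableSet_path hJ.measurable_state m x
  -- The left side also involves `Y (m + 1)`, so each path event is split according to the next
  -- state.
  have hsplit : {ω | ∀ k ≤ m, Y k ω = x k} =
      ⋃ z, {ω | ∀ k ≤ m + 1, Y k ω = if k ≤ m then x k else z} := by
    ext ω
    simp only [Set.mem_ofPred_eq, Set.mem_iUnion]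
    refine ⟨fun h => ⟨Y (m + 1) ω, fun k hk => ?_⟩, fun ⟨z, hz⟩ k hk => ?_⟩
    · split_ifs with hkm
      · exact h k hkm
      · rw [show k = m + 1 by omega]
    · have := hz k (by omega)
      rwa [if_pos hk] at this
  have hright : ∫⁻ ω in {ω | ∀ k ≤ m, Y k ω = x k}, pathWeight l n Y H m ω *
        (if Y m ω < n then ENNReal.ofReal (-Q (Y m ω) (Y m ω) / (-Q (Y m ω) (Y m ω) + l (Y m ω))) *
          ∑' z, ENNReal.ofReal (jumpProb Q (Y m ω) z) * f z else 0) ∂μ =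
      (∫⁻ ω in {ω | ∀ k ≤ m, Y k ω = x k}, pathWeight l n Y H m ω ∂μ) *
        (if x m < n then ENNReal.ofReal (-Q (x m) (x m) / (-Q (x m) (x m) + l (x m))) *
          ∑' z, ENNReal.ofReal (jumpProb Q (x m) z) * f z else 0) := by
    rw [← lintegral_mul_const _ (measurable_pathWeight hJ l n m)]
    refine setLIntegral_congr_fun hB fun ω hω => ?_
    simp only [hω m le_rfl]
  rw [hright, setLIntegral_pathWeight hQ hJ hl n m m (by omega) x]
  conv_lhs => rw [hsplit]
  rw [lintegral_iUnion (fun z => measurableSet_path hJ.measurable_state (m + 1) _)]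
  · have hterm : ∀ z, ∫⁻ ω in {ω | ∀ k ≤ m + 1, Y k ω = if k ≤ m then x k else z},
        pathWeight l n Y H (m + 1) ω * f (Y (m + 1) ω) ∂μ =
        μ {ω | ∀ k ≤ m, Y k ω = x k} * (∏ k ∈ Finset.range m,
          if x k < n then ENNReal.ofReal (-Q (x k) (x k) / (-Q (x k) (x k) + l (x k))) else 0) *
        ((if x m < n then ENNReal.ofReal (-Q (x m) (x m) / (-Q (x m) (x m) + l (x m))) else 0) *
          (ENNReal.ofReal (jumpProb Q (x m) z) * f z)) := by
      intro z
      set w : ℕ → ℕ := fun k => if k ≤ m then x k else z with hw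
      have hwx : ∀ k ≤ m, w k = x k := fun k hk => if_pos hk
      have hwz : w (m + 1) = z := if_neg (by omega)
      have hmu : μ {ω | ∀ k ≤ m + 1, Y k ω = w k} =
          μ {ω | ∀ k ≤ m, Y k ω = x k} * ENNReal.ofReal (jumpProb Q (x m) z) := by
        rw [hJ.jump_chain, hJ.jump_chain, Finset.prod_range_succ, hwx 0 (Nat.zero_le m),
          hwx m le_rfl, hwz, ← ENNReal.ofReal_mul, mul_assoc]
        · rw [Finset.prod_congr rfl fun k hk => by
            have := Finset.mem_range.1 hk
            rw [hwx k (by omega), hwx (k + 1) (by omega)]]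
        · exact mul_nonneg (by split_ifs <;> norm_num)
            (Finset.prod_nonneg fun k _ => hQ.jumpProb_nonneg _ _)
      have hcongr : ∀ ω ∈ {ω | ∀ k ≤ m + 1, Y k ω = w k},
          pathWeight l n Y H (m + 1) ω * f (Y (m + 1) ω) = pathWeight l n Y H (m + 1) ω * f z := by
        intro ω hω
        rw [hω (m + 1) le_rfl, hwz]
      rw [setLIntegral_congr_fun (measurableSet_path hJ.measurable_state (m + 1) w) hcongr,
        lintegral_mul_const _ (measurable_pathWeight hJ l n (m + 1)),
        setLIntegral_pathWeight hQ hJ hl n (m + 1) (m + 1) (by omega) w, hmu,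
        Finset.prod_range_succ, hwx m le_rfl,
        Finset.prod_congr rfl fun k hk => by rw [hwx k (Finset.mem_range.1 hk).le]]
      ring
    rw [tsum_congr hterm, ENNReal.tsum_mul_left, ENNReal.tsum_mul_left]
    congr 1
    split_ifs <;> simp
  · intro z z' hne
    refine Set.disjoint_left.2 fun ω h h' => hne ?_
    have h1 := h (m + 1) le_rfl
    have h2 := h' (m + 1) le_rfl
    rw [if_neg (by omega)] at h1 h2
    exact h1.symm.trans h2

end PathSums

end SkipFree

/-! ### Optional stopping at the hitting time of `n` -/

namespace SkipFree
open MeasureTheory Filter Topology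

section PathWeight

variable {Ω : Type*} {Y : ℕ → Ω → ℕ} {H : ℕ → Ω → ℝ≥0}

lemma pathWeight_le {l : ℕ → ℝ} (hl : ∀ i, 0 ≤ l i) (n m : ℕ) (ω : Ω) :
    pathWeight l n Y H m ω ≤ if ∀ k < m, Y k ω < n then 1 else 0 := by
  split_ifs with h
  · refine Finset.prod_le_one' fun k _ => ?_
    split_ifs
    · rw [ENNReal.ofReal_le_one, Real.exp_le_one_iff, neg_mul, neg_nonpos]
      exact mul_nonneg (hl _) (H k ω).2
    · exact zero_le_one
  · push Not at h
    obtain ⟨k, hk, hkn⟩ := h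
    rw [pathWeight, Finset.prod_eq_zero (Finset.mem_range.2 hk)]
    rw [if_neg (by omega)]

/-- The first states of the path are below `n` until `n` is reached at step `m`. -/
def HitsAt (n : ℕ) (Y : ℕ → Ω → ℕ) (m : ℕ) (ω : Ω) : Prop :=
  Y m ω = n ∧ ∀ k < m, Y k ω < n

/-- Paths are killed at `n` itself, so later visits to `n` carry weight zero and only the first one
counts. -/
lemma tsum_pathWeight_of_hitsAt (l : ℕ → ℝ) {n m : ℕ} {ω : Ω} (h : HitsAt n Y m ω) :
    ∑' j, pathWeight l n Y H j ω * (if Y j ω = n then 1 else 0) = pathWeight l n Y H m ω := by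
  rw [tsum_eq_single m, if_pos h.1, mul_one]
  intro j hj
  rcases lt_or_gt_of_ne hj with h1 | h1
  · rw [if_neg (h.2 j h1).ne, mul_zero]
  · rw [pathWeight, Finset.prod_eq_zero (Finset.mem_range.2 h1), zero_mul]
    rw [if_neg (by rw [h.1]; exact lt_irrefl n)]

lemma tsum_pathWeight_le {l : ℕ → ℝ} (hl : ∀ i, 0 ≤ l i) (n : ℕ) (ω : Ω) :
    ∑' j, pathWeight l n Y H j ω * (if Y j ω = n then 1 else 0) ≤
      {ω | ∃ m, HitsAt n Y m ω}.indicator 1 ω := by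
  by_cases h : ∃ m, HitsAt n Y m ω
  · rw [Set.indicator_of_mem (show ω ∈ {ω | ∃ m, HitsAt n Y m ω} from h)]
    obtain ⟨m, hm⟩ := h
    rw [tsum_pathWeight_of_hitsAt l hm]
    refine (pathWeight_le hl n m ω).trans ?_
    split_ifs
    · exact le_rfl
    · exact zero_le
  · refine le_of_eq_of_le (ENNReal.tsum_eq_zero.2 fun j => ?_) zero_le
    by_cases hj : Y j ω = n
    · have h1 : ¬ ∀ k < j, Y k ω < n := fun hk => h ⟨j, hj, hk⟩
      have h2 := pathWeight_le (Y := Y) (H := H) hl n j ω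
      rw [if_neg h1] at h2
      rw [le_antisymm h2 zero_le, zero_mul]
    · rw [if_neg hj, mul_zero]

end PathWeight

section Hitting

variable {Ω : Type*} [MeasurableSpace Ω] {μ : Measure Ω} {Q : Matrix ℕ ℕ ℝ}
  {X : ℝ≥0 → Ω → ℕ} {Y : ℕ → Ω → ℕ} {H : ℕ → Ω → ℝ≥0}

lemma measurable_pathWeight_mul {x₀ : ℕ} (hJ : IsJumpDescription μ Q x₀ X Y H) (l : ℕ → ℝ)
    (n m : ℕ) (f : ℕ → ℝ≥0∞) : Measurable fun ω => pathWeight l n Y H m ω * f (Y m ω) :=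
  (measurable_pathWeight hJ l n m).mul ((measurable_from_top (f := f)).comp (hJ.measurable_state m))

lemma ae_state_zero {x₀ : ℕ} [IsProbabilityMeasure μ] (hJ : IsJumpDescription μ Q x₀ X Y H) :
    ∀ᵐ ω ∂μ, Y 0 ω = x₀ := by
  have h := hJ.jump_chain 0 fun _ => x₀
  have hm := measurableSet_path hJ.measurable_state 0 fun _ => x₀
  simp only [Nat.le_zero, forall_eq, if_true, Finset.range_zero, Finset.prod_empty, mul_one,
    ENNReal.ofReal_one] at h hm
  exact (prob_compl_eq_zero_iff hm).2 h

/-- Optional stopping of the harmonic solution at the hitting time of `n`. -/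
lemma harmonicSolution_mul_sum_add (hQ : IsSkipFreeGenerator Q)
    (hJ : IsJumpDescription μ Q 0 X Y H) [IsProbabilityMeasure μ] {l : ℕ → ℝ}
    (hl : ∀ i, 0 ≤ l i) (n m : ℕ) :
    ENNReal.ofReal (harmonicSolution Q l n) *
        ∑ j ∈ Finset.range m, ∫⁻ ω, pathWeight l n Y H j ω * (if Y j ω = n then 1 else 0) ∂μ +
      ∫⁻ ω, pathWeight l n Y H m ω *
        (if Y m ω ≤ n then ENNReal.ofReal (harmonicSolution Q l (Y m ω)) else 0) ∂μ = 1 := by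
  induction m with
  | zero =>
    have : ∫⁻ ω, pathWeight l n Y H 0 ω *
        (if Y 0 ω ≤ n then ENNReal.ofReal (harmonicSolution Q l (Y 0 ω)) else 0) ∂μ =
        ∫⁻ _, 1 ∂μ := by
      refine lintegral_congr_ae ?_
      filter_upwards [ae_state_zero hJ] with ω hω
      simp [pathWeight, hω]
    rw [this]
    simp
  | succ m ih =>
    refine Eq.trans ?_ ih
    rw [Finset.sum_range_succ, mul_add, add_assoc]
    congr 1
    rw [lintegral_pathWeight_succ hQ hJ hl n m fun x =>
        if x ≤ n then ENNReal.ofReal (harmonicSolution Q l x) else 0,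
      ← lintegral_const_mul _ (measurable_pathWeight_mul hJ l n m fun x => if x = n then 1 else 0),
      ← lintegral_add_left ((measurable_pathWeight_mul hJ l n m
        fun x => if x = n then 1 else 0).const_mul _)]
    refine lintegral_congr fun ω => ?_
    generalize Y m ω = x
    rw [mul_left_comm, ← mul_add]
    congr 1
    rcases lt_trichotomy x n with hx | hx | hx
    · rw [if_neg hx.ne, if_pos hx, if_pos hx.le, mul_zero, zero_add]
      have hr : 0 < -Q x x := neg_pos.2 (hQ.diag_neg x)
      have hP := one_le_harmonicSolution hQ hl
      -- From `x < n` the chain jumps at most to `x + 1 ≤ n`, so the truncation at `n` loses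
      -- nothing.
      have hf : ∀ z, ENNReal.ofReal (jumpProb Q x z) *
          (if z ≤ n then ENNReal.ofReal (harmonicSolution Q l z) else 0) =
          ENNReal.ofReal (jumpProb Q x z) * ENNReal.ofReal (harmonicSolution Q l z) := by
        intro z
        split_ifs with hz
        · rfl
        · rw [jumpProb, if_neg (by omega), hQ.skip_free x z (by omega)]
          simp
      rw [tsum_congr hf, hQ.tsum_jumpProb x fun z => zero_le_one.trans (hP z),
        ← ENNReal.ofReal_mul (div_nonneg hr.le (add_nonneg hr.le (hl x)))]
      congr 1
      -- The equation for `h` says that its sum over jumps from `x` is `(-Q x x + l x) * h x`; the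
      -- survival factor `-Q x x / (-Q x x + l x)` turns the one-step mean back into `h x`.
      rw [harmonicSolution_succ hQ]
      have hrl : 0 < -Q x x + l x := add_pos_of_pos_of_nonneg hr (hl x)
      rw [sub_add_cancel, div_mul_div_comm, mul_comm (-Q x x + l x) (-Q x x),
        mul_div_mul_left _ _ hr.ne', div_eq_iff hrl.ne']
      ring
    · subst hx; simp
    · rw [if_neg (by omega), if_neg (by omega), if_neg (by omega)]; simp

/-- The remainder in the stopping identity is at most `h n` times the mass at `n` plus the mass
below `n`, by monotonicity of `h`. The masses at `n` are summable by the identity itself; the masses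
below `n` vanish by `hlim`, which is first available for strictly positive killing and, once `n` is
known to be reached, for all rates. -/
lemma harmonicSolution_mul_tsum (hQ : IsSkipFreeGenerator Q)
    (hJ : IsJumpDescription μ Q 0 X Y H) [IsProbabilityMeasure μ] {l : ℕ → ℝ}
    (hl : ∀ i, 0 ≤ l i) (n : ℕ)
    (hlim : Tendsto (fun m => ∫⁻ ω, pathWeight l n Y H m ω * (if Y m ω < n then 1 else 0) ∂μ)
      atTop (𝓝 0)) :
    ENNReal.ofReal (harmonicSolution Q l n) *
      ∫⁻ ω, ∑' j, pathWeight l n Y H j ω * (if Y j ω = n then 1 else 0) ∂μ = 1 := by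
  have hP := monotone_harmonicSolution hQ hl
  rw [lintegral_tsum fun j =>
    (measurable_pathWeight_mul hJ l n j fun x => if x = n then 1 else 0).aemeasurable]
  set a := fun j => ∫⁻ ω, pathWeight l n Y H j ω * (if Y j ω = n then 1 else 0) ∂μ
  have h1 : Tendsto (fun m => ENNReal.ofReal (harmonicSolution Q l n) *
      ∑ j ∈ Finset.range m, a j) atTop
      (𝓝 (ENNReal.ofReal (harmonicSolution Q l n) * ∑' j, a j)) :=
    ENNReal.Tendsto.const_mul (ENNReal.tendsto_nat_tsum a) (Or.inr ENNReal.ofReal_ne_top)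
  set b := fun m => ∫⁻ ω, pathWeight l n Y H m ω *
    (if Y m ω ≤ n then ENNReal.ofReal (harmonicSolution Q l (Y m ω)) else 0) ∂μ with hb
  set g := fun m => ∫⁻ ω, pathWeight l n Y H m ω * (if Y m ω < n then 1 else 0) ∂μ with hg
  have hbg : ∀ m, b m ≤ ENNReal.ofReal (harmonicSolution Q l n) * (a m + g m) := by
    intro m
    simp only [hb, hg, a]
    rw [← lintegral_add_left
      (measurable_pathWeight_mul hJ l n m fun x => if x = n then 1 else 0),
      ← lintegral_const_mul' _ _ ENNReal.ofReal_ne_top]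
    refine lintegral_mono fun ω => ?_
    simp only
    rw [← mul_add, mul_left_comm]
    refine mul_le_mul_right ?_ _
    rcases lt_trichotomy (Y m ω) n with hx | hx | hx
    · rw [if_neg hx.ne, if_pos hx, if_pos hx.le, zero_add, mul_one]
      exact ENNReal.ofReal_le_ofReal (hP hx.le)
    · simp [hx]
    · rw [if_neg (by omega)]; exact zero_le
  have ha : ∑' j, a j ≠ ∞ := by
    intro htop
    have hle : ENNReal.ofReal (harmonicSolution Q l n) * ∑' j, a j ≤ 1 :=
      le_of_tendsto h1 (Eventually.of_forall fun m => by
        rw [← harmonicSolution_mul_sum_add hQ hJ hl n m]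
        exact le_self_add)
    rw [htop, ENNReal.mul_top] at hle
    · exact absurd hle (by simp)
    · exact (ENNReal.ofReal_pos.2 (lt_of_lt_of_le one_pos (one_le_harmonicSolution hQ hl n))).ne'
  have h2 : Tendsto b atTop (𝓝 0) := by
    refine tendsto_of_tendsto_of_tendsto_of_le_of_le tendsto_const_nhds ?_ (fun _ => zero_le) hbg
    have h3 := ENNReal.Tendsto.const_mul (a := ENNReal.ofReal (harmonicSolution Q l n))
      ((ENNReal.tendsto_atTop_zero_of_tsum_ne_top ha).add hlim) (Or.inr ENNReal.ofReal_ne_top)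
    simpa using h3
  have h3 := h1.add h2
  rw [add_zero] at h3
  refine tendsto_nhds_unique h3 ?_
  refine tendsto_const_nhds.congr fun m => ?_
  exact (harmonicSolution_mul_sum_add hQ hJ hl n m).symm

lemma measurableSet_hits (hY : ∀ k, Measurable (Y k)) (n : ℕ) :
    MeasurableSet {ω | ∃ m, HitsAt n Y m ω} := by
  have : {ω | ∃ m, HitsAt n Y m ω} =
      ⋃ m, (Y m ⁻¹' {n} ∩ ⋂ k ∈ Finset.range m, Y k ⁻¹' Set.Iio n) := by
    ext; simp [HitsAt]
  rw [this]
  exact MeasurableSet.iUnion fun m => (hY m (measurableSet_singleton n)).inter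
    (Finset.measurableSet_biInter _ fun k _ => hY k measurableSet_Iio)

/-- The chain reaches `n` almost surely. -/
lemma ae_exists_hitsAt (hQ : IsSkipFreeGenerator Q) (hJ : IsJumpDescription μ Q 0 X Y H)
    [IsProbabilityMeasure μ] (n : ℕ) : ∀ᵐ ω ∂μ, ∃ m, HitsAt n Y m ω := by
  have hmeas := measurableSet_hits hJ.measurable_state n
  refine (prob_compl_eq_zero_iff hmeas).2 (le_antisymm prob_le_one ?_)
  -- Killing at `s` times the holding rate gives survival probability `1 / (1 + s)` per step in
  -- every state, so the mass below `n` decays geometrically. Letting `s` tend to `0` then removes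
  -- the killing.
  have hbound : ∀ s : ℝ, 0 < s →
      1 ≤ ENNReal.ofReal (harmonicSolution Q (fun i => s * -Q i i) n) *
        μ {ω | ∃ m, HitsAt n Y m ω} := by
    intro s hs
    set l : ℕ → ℝ := fun i => s * -Q i i with hl'
    have hl : ∀ i, 0 ≤ l i := fun i => mul_nonneg hs.le (neg_pos.2 (hQ.diag_neg i)).le
    rw [← harmonicSolution_mul_tsum hQ hJ hl n, ← lintegral_indicator_one hmeas]
    · gcongr with ω
      exact tsum_pathWeight_le hl n ω
    · set g := fun m => ∫⁻ ω, pathWeight l n Y H m ω * (if Y m ω < n then 1 else 0) ∂μ with hg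
      have hstep : ∀ m, g (m + 1) ≤ ENNReal.ofReal (1 + s)⁻¹ * g m := by
        intro m
        simp only [hg]
        rw [lintegral_pathWeight_succ hQ hJ hl n m fun x => if x < n then 1 else 0,
          ← lintegral_const_mul' _ _ ENNReal.ofReal_ne_top]
        refine lintegral_mono fun ω => ?_
        simp only
        rw [mul_left_comm]
        refine mul_le_mul_right ?_ _
        generalize Y m ω = x
        split_ifs with hx
        · have hr : 0 < -Q x x := neg_pos.2 (hQ.diag_neg x)
          have h1 : -Q x x / (-Q x x + l x) = (1 + s)⁻¹ := by
            have : -Q x x + l x = -Q x x * (1 + s) := by rw [hl']; ring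
            rw [this, div_mul_eq_div_div, div_self hr.ne', one_div]
          rw [h1]
          refine mul_le_mul_right ?_ _
          calc ∑' z, ENNReal.ofReal (jumpProb Q x z) * (if z < n then 1 else 0)
              ≤ ∑' z, ENNReal.ofReal (jumpProb Q x z) * ENNReal.ofReal 1 := by
                refine ENNReal.tsum_le_tsum fun z => mul_le_mul_right ?_ _
                split_ifs <;> simp
            _ = 1 := by
                rw [hQ.tsum_jumpProb x fun _ => zero_le_one]
                have := hQ.diag_eq x
                simp only [mul_one]
                rw [← this, div_self hr.ne', ENNReal.ofReal_one]
        · exact zero_le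
      have hgeom : ∀ m, g m ≤ ENNReal.ofReal (1 + s)⁻¹ ^ m := by
        intro m
        induction m with
        | zero =>
          simp only [hg, pow_zero]
          calc _ ≤ ∫⁻ _, 1 ∂μ := by
                refine lintegral_mono fun ω => ?_
                simp only [pathWeight, Finset.range_zero, Finset.prod_empty, one_mul]
                split_ifs <;> simp
            _ = 1 := by simp
        | succ m ih =>
          rw [pow_succ']
          exact (hstep m).trans (mul_le_mul_right ih _)
      refine tendsto_of_tendsto_of_tendsto_of_le_of_le tendsto_const_nhds
        (ENNReal.tendsto_pow_atTop_nhds_zero_of_lt_one ?_) (fun _ => zero_le) hgeom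
      rw [ENNReal.ofReal_lt_one]
      exact inv_lt_one_of_one_lt₀ (by linarith)
  have hcont : Continuous fun s : ℝ => harmonicSolution Q (fun i => s * -Q i i) n :=
    continuous_harmonicSolution_comp hQ (fun i => by fun_prop) n
  have hlim : Tendsto (fun s : ℝ => ENNReal.ofReal (harmonicSolution Q (fun i => s * -Q i i) n) *
        μ {ω | ∃ m, HitsAt n Y m ω}) (𝓝[>] 0) (𝓝 (μ {ω | ∃ m, HitsAt n Y m ω})) := by
    have h1 := (ENNReal.continuous_ofReal.comp hcont).tendsto 0
    simp only [Function.comp_def] at h1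
    rw [harmonicSolution_eq_one hQ (by simp), ENNReal.ofReal_one] at h1
    have h2 := ENNReal.Tendsto.mul_const (b := μ {ω | ∃ m, HitsAt n Y m ω})
      (h1.mono_left (nhdsWithin_le_nhds (s := Set.Ioi 0))) (Or.inl one_ne_zero)
    rwa [one_mul] at h2
  exact ge_of_tendsto hlim (eventually_nhdsWithin_of_forall hbound)

/-- The Laplace transform of the path up to the hitting time of `n`. -/
lemma lintegral_tsum_pathWeight (hQ : IsSkipFreeGenerator Q)
    (hJ : IsJumpDescription μ Q 0 X Y H) [IsProbabilityMeasure μ] {l : ℕ → ℝ}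
    (hl : ∀ i, 0 ≤ l i) (n : ℕ) :
    ∫⁻ ω, ∑' j, pathWeight l n Y H j ω * (if Y j ω = n then 1 else 0) ∂μ =
      ENNReal.ofReal (harmonicSolution Q l n)⁻¹ := by
  have hpos : 0 < harmonicSolution Q l n :=
    lt_of_lt_of_le one_pos (one_le_harmonicSolution hQ hl n)
  rw [ENNReal.ofReal_inv_of_pos hpos]
  refine ENNReal.eq_inv_of_mul_eq_one_left ?_
  rw [mul_comm]
  refine harmonicSolution_mul_tsum hQ hJ hl n ?_
  have hA : ∀ m, MeasurableSet {ω | ∀ k ≤ m, Y k ω < n} := by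
    intro m
    have : {ω | ∀ k ≤ m, Y k ω < n} = ⋂ k ∈ Finset.range (m + 1), Y k ⁻¹' Set.Iio n := by
      ext; simp
    rw [this]
    exact Finset.measurableSet_biInter _ fun k _ => hJ.measurable_state k measurableSet_Iio
  -- Since `n` is reached almost surely, the paths still below `n` have vanishing measure, whatever
  -- the killing.
  have hlim : Tendsto (fun m => μ {ω | ∀ k ≤ m, Y k ω < n}) atTop (𝓝 0) := by
    have h := tendsto_measure_iInter_atTop (μ := μ) (s := fun m => {ω | ∀ k ≤ m, Y k ω < n})
      (fun m => (hA m).nullMeasurableSet)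
      (fun m m' hm ω hω k hk => hω k (hk.trans hm)) ⟨0, measure_ne_top _ _⟩
    have h0 : μ (⋂ m, {ω | ∀ k ≤ m, Y k ω < n}) = 0 := by
      refine measure_mono_null (fun ω hω => ?_) (ae_iff.1 (ae_exists_hitsAt hQ hJ n))
      rintro ⟨m, hm, -⟩
      exact absurd hm (Set.mem_iInter.1 hω m m le_rfl).ne
    rwa [h0] at h
  refine tendsto_of_tendsto_of_tendsto_of_le_of_le tendsto_const_nhds hlim
    (fun _ => zero_le) fun m => ?_
  simp only
  rw [← lintegral_indicator_one (hA m)]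
  refine lintegral_mono fun ω => ?_
  by_cases hω : ∀ k ≤ m, Y k ω < n
  · rw [Set.indicator_of_mem (show ω ∈ {ω | ∀ k ≤ m, Y k ω < n} from hω)]
    refine (mul_le_mul' (pathWeight_le hl n m ω) le_rfl).trans ?_
    split_ifs <;> simp
  · push Not at hω
    obtain ⟨k, hk, hkn⟩ := hω
    refine le_of_eq_of_le ?_ zero_le
    rcases hk.lt_or_eq with h | rfl
    · rw [pathWeight, Finset.prod_eq_zero (Finset.mem_range.2 h), zero_mul]
      rw [if_neg (by omega)]
    · rw [if_neg (by omega), mul_zero]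

end Hitting

end SkipFree

/-! ### Occupation times as sums of holding times -/

namespace SkipFree
open MeasureTheory

section OccupationTime

variable {Ω : Type*} {X : ℝ≥0 → Ω → ℕ} {Y : ℕ → Ω → ℕ} {H : ℕ → Ω → ℝ≥0}

lemma transitionTime_succ (k : ℕ) (ω : Ω) :
    transitionTime H (k + 1) ω = transitionTime H k ω + H k ω :=
  Finset.sum_range_succ _ _

lemma monotone_transitionTime (ω : Ω) : Monotone fun k => transitionTime H k ω :=
  monotone_nat_of_le_succ fun k => by rw [transitionTime_succ]; exact le_self_add

lemma exists_mem_Ico_transitionTime {ω : Ω} {t : ℝ≥0} {m : ℕ} (h : t < transitionTime H m ω) :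
    ∃ k < m, transitionTime H k ω ≤ t ∧ t < transitionTime H (k + 1) ω := by
  induction m with
  | zero => simp [transitionTime] at h
  | succ m ih =>
    rcases lt_or_ge t (transitionTime H m ω) with h1 | h1
    · obtain ⟨k, hk, hkt⟩ := ih h1
      exact ⟨k, by omega, hkt⟩
    · exact ⟨m, by omega, h1, h⟩

/-- The hitting time of `n` is a transition time. -/
lemma hittingAfter_eq_transitionTime {n m : ℕ} {ω : Ω}
    (hpath : ∀ (k : ℕ) (t : ℝ≥0), transitionTime H k ω ≤ t → t < transitionTime H (k + 1) ω →
      X t ω = Y k ω) (hpos : ∀ k, 0 < H k ω) (hm : HitsAt n Y m ω) :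
    hittingAfter X {n} 0 ω = (transitionTime H m ω : WithTop ℝ≥0) := by
  have hhit : X (transitionTime H m ω) ω = n := by
    rw [hpath m _ le_rfl (by rw [transitionTime_succ]; exact lt_add_of_pos_right _ (hpos m)), hm.1]
  rw [hittingAfter, if_pos ⟨_, zero_le, hhit⟩]
  congr 1
  refine IsLeast.csInf_eq ⟨⟨zero_le, hhit⟩, fun t ht => ?_⟩
  by_contra hlt
  obtain ⟨k, hk, h1, h2⟩ := exists_mem_Ico_transitionTime (not_le.1 hlt)
  have := hm.2 k hk
  rw [← hpath k t h1 h2] at this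
  exact this.ne ht.2

/-- The occupation times before the hitting time of `n`, in terms of the embedded chain and the
holding times. -/
lemma occupationTime_eq_sum {n m i : ℕ} {ω : Ω}
    (hpath : ∀ (k : ℕ) (t : ℝ≥0), transitionTime H k ω ≤ t → t < transitionTime H (k + 1) ω →
      X t ω = Y k ω) (hpos : ∀ k, 0 < H k ω) (hm : HitsAt n Y m ω) :
    occupationTime X n i ω = ∑ k ∈ Finset.range m, if Y k ω = i then (H k ω : ℝ≥0∞) else 0 := by
  have hset : (fun t : ℝ≥0 => (t : ℝ)) ''
      {t | X t ω = i ∧ (t : WithTop ℝ≥0) < hittingAfter X {n} 0 ω} =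
      ⋃ k ∈ (Finset.range m).filter fun k => Y k ω = i,
        Set.Ico (transitionTime H k ω : ℝ) (transitionTime H (k + 1) ω) := by
    rw [hittingAfter_eq_transitionTime hpath hpos hm]
    ext x
    simp only [Set.mem_image, Set.mem_ofPred_eq, WithTop.coe_lt_coe, Set.mem_iUnion,
      Finset.mem_filter, Finset.mem_range, Set.mem_Ico, exists_prop]
    constructor
    · rintro ⟨t, ⟨hX, ht⟩, rfl⟩
      obtain ⟨k, hk, h1, h2⟩ := exists_mem_Ico_transitionTime ht
      exact ⟨k, ⟨hk, (hpath k t h1 h2).symm.trans hX⟩, NNReal.coe_le_coe.2 h1,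
        NNReal.coe_lt_coe.2 h2⟩
    · rintro ⟨k, ⟨hk, hY⟩, h1, h2⟩
      lift x to ℝ≥0 using (transitionTime H k ω).2.trans h1
      rw [NNReal.coe_le_coe] at h1
      rw [NNReal.coe_lt_coe] at h2
      exact ⟨x, ⟨(hpath k x h1 h2).trans hY, h2.trans_le (monotone_transitionTime ω hk)⟩, rfl⟩
  have hmono : Monotone fun k => (transitionTime H k ω : ℝ) := fun a b hab =>
    NNReal.coe_le_coe.2 (monotone_transitionTime ω hab)
  have hdisj : Pairwise (Function.onFun Disjoint fun k =>
      Set.Ico (transitionTime H k ω : ℝ) (transitionTime H (k + 1) ω)) :=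
    hmono.pairwise_disjoint_on_Ico_succ
  rw [occupationTime, hset, measure_biUnion_finset (fun a _ b _ hab => hdisj hab)
    (fun _ _ => measurableSet_Ico), Finset.sum_filter]
  refine Finset.sum_congr rfl fun k _ => ?_
  rw [Real.volume_Ico, transitionTime_succ, NNReal.coe_add, add_sub_cancel_left,
    ENNReal.ofReal_coe_nnreal]

lemma pathWeight_eq_exp_occupationTime {n m : ℕ} {ω : Ω} (l : ℕ → ℝ)
    (hpath : ∀ (k : ℕ) (t : ℝ≥0), transitionTime H k ω ≤ t → t < transitionTime H (k + 1) ω →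
      X t ω = Y k ω) (hpos : ∀ k, 0 < H k ω) (hm : HitsAt n Y m ω) :
    pathWeight l n Y H m ω = ENNReal.ofReal
      (Real.exp (-∑ i ∈ Finset.range n, l i * (occupationTime X n i ω).toReal)) := by
  have hocc : ∀ i, (occupationTime X n i ω).toReal =
      ∑ k ∈ Finset.range m, if Y k ω = i then (H k ω : ℝ) else 0 := by
    intro i
    rw [occupationTime_eq_sum hpath hpos hm, ENNReal.toReal_sum fun k _ => by
      split_ifs <;> simp]
    exact Finset.sum_congr rfl fun k _ => by split_ifs <;> simp
  have hsum : ∑ i ∈ Finset.range n, l i * (occupationTime X n i ω).toReal =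
      ∑ k ∈ Finset.range m, l (Y k ω) * H k ω := by
    simp only [hocc, Finset.mul_sum]
    rw [Finset.sum_comm]
    refine Finset.sum_congr rfl fun k hk => ?_
    rw [Finset.sum_eq_single (Y k ω)]
    · rw [if_pos rfl]
    · intro i _ hi
      rw [if_neg hi.symm, mul_zero]
    · intro h
      exact absurd (Finset.mem_range.2 (hm.2 k (Finset.mem_range.1 hk))) h
  rw [hsum, ← Finset.sum_neg_distrib, Real.exp_sum,
    ENNReal.ofReal_prod_of_nonneg fun _ _ => (Real.exp_pos _).le, pathWeight]
  refine Finset.prod_congr rfl fun k hk => ?_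
  rw [if_pos (hm.2 k (Finset.mem_range.1 hk)), neg_mul]

variable [MeasurableSpace Ω] {μ : Measure Ω} [IsProbabilityMeasure μ] {Q : Matrix ℕ ℕ ℝ}

lemma ae_occupationTime_ne_top (hQ : IsSkipFreeGenerator Q)
    (hJ : IsJumpDescription μ Q 0 X Y H) (n i : ℕ) :
    ∀ᵐ ω ∂μ, occupationTime X n i ω ≠ ∞ := by
  filter_upwards [hJ.path, hJ.ae_holding_pos, ae_exists_hitsAt hQ hJ n] with ω h1 h2 ⟨m, hm⟩
  rw [occupationTime_eq_sum h1 h2 hm]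
  exact ENNReal.sum_ne_top.2 fun k _ => by split_ifs <;> simp

/-- `X` is prescribed only almost surely and before explosion, so measurability comes from an almost
everywhere equal expression in `Y` and `H`, split according to the step at which `n` is first
reached. -/
lemma aemeasurable_occupationTime (hQ : IsSkipFreeGenerator Q)
    (hJ : IsJumpDescription μ Q 0 X Y H) (n i : ℕ) : AEMeasurable (occupationTime X n i) μ := by
  classical
  refine ⟨fun ω => ∑' m, {ω | HitsAt n Y m ω}.indicator
    (fun ω => ∑ k ∈ Finset.range m, if Y k ω = i then (H k ω : ℝ≥0∞) else 0) ω, ?_, ?_⟩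
  · refine Measurable.tsum fun m => Measurable.indicator
      (Finset.measurable_sum _ fun k _ => Measurable.ite
        (hJ.measurable_state k (measurableSet_singleton i))
        (hJ.measurable_holding k).coe_nnreal_ennreal measurable_const) ?_
    have : {ω | HitsAt n Y m ω} = Y m ⁻¹' {n} ∩ ⋂ k ∈ Finset.range m, Y k ⁻¹' Set.Iio n := by
      ext; simp [HitsAt]
    rw [this]
    exact (hJ.measurable_state m (measurableSet_singleton n)).inter
      (Finset.measurableSet_biInter _ fun k _ => hJ.measurable_state k measurableSet_Iio)
  · filter_upwards [hJ.path, hJ.ae_holding_pos, ae_exists_hitsAt hQ hJ n] with ω h1 h2 ⟨m, hm⟩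
    rw [occupationTime_eq_sum h1 h2 hm, tsum_eq_single m]
    · rw [Set.indicator_of_mem (show ω ∈ {ω | HitsAt n Y m ω} from hm)]
    · intro j hj
      rw [Set.indicator_of_notMem]
      intro (h : HitsAt n Y j ω)
      rcases lt_or_gt_of_ne hj with h' | h'
      · exact (hm.2 j h').ne h.1
      · exact (h.2 m h').ne hm.1

/-- The joint Laplace transform of the occupation times. -/
theorem lintegral_exp_occupationTime (hQ : IsSkipFreeGenerator Q)
    (hJ : IsJumpDescription μ Q 0 X Y H) {l : ℕ → ℝ} (hl : ∀ i, 0 ≤ l i) (n : ℕ) :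
    ∫⁻ ω, ENNReal.ofReal
        (Real.exp (-∑ i ∈ Finset.range n, l i * (occupationTime X n i ω).toReal)) ∂μ =
      ENNReal.ofReal (harmonicSolution Q l n)⁻¹ := by
  rw [← lintegral_tsum_pathWeight hQ hJ hl n]
  refine lintegral_congr_ae ?_
  filter_upwards [hJ.path, hJ.ae_holding_pos, ae_exists_hitsAt hQ hJ n] with ω h1 h2 ⟨m, hm⟩
  rw [tsum_pathWeight_of_hitsAt l hm, pathWeight_eq_exp_occupationTime l h1 h2 hm]

end OccupationTime

end SkipFree

/-! ### Uniqueness of Laplace transforms and conditional distributions -/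

namespace SkipFree
open MeasureTheory ProbabilityTheory
open scoped BoundedContinuousFunction

/-- The function `x ↦ exp (-x)` on `[0, ∞)`. -/
noncomputable def expNegBCF : ℝ≥0 →ᵇ ℝ :=
  BoundedContinuousFunction.ofNormedAddCommGroup (fun x : ℝ≥0 => Real.exp (-x)) (by fun_prop) 1
    fun x => by
      rw [Real.norm_eq_abs, abs_of_pos (Real.exp_pos _), Real.exp_le_one_iff, neg_nonpos]
      exact x.2

lemma expNegBCF_apply (x : ℝ≥0) : expNegBCF x = Real.exp (-x) := rfl

/-- A finite measure on `[0, ∞)` is determined by its Laplace transform on `ℕ`. -/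
lemma measure_ext_of_laplace_nat {P P' : Measure ℝ≥0} [IsFiniteMeasure P] [IsFiniteMeasure P']
    (h : ∀ k : ℕ, ∫⁻ x : ℝ≥0, ENNReal.ofReal (Real.exp (-(k * x))) ∂P =
      ∫⁻ x : ℝ≥0, ENNReal.ofReal (Real.exp (-(k * x))) ∂P') : P = P' := by
  -- Polynomials in `exp (-x)` separate points, and their integrals are linear combinations of
  -- Laplace transforms at natural numbers.
  let A : StarSubalgebra ℝ (ℝ≥0 →ᵇ ℝ) :=
    { (Polynomial.aeval (R := ℝ) expNegBCF).range with
      star_mem' := fun {f} hf => by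
        have : star f = f := by ext x; simp
        rw [this]; exact hf }
  have hmem : ∀ f, f ∈ A ↔ ∃ p : Polynomial ℝ, Polynomial.aeval expNegBCF p = f := fun f => Iff.rfl
  refine ext_of_forall_mem_subalgebra_integral_eq_of_polish (𝕜 := ℝ) (A := A) ?_ ?_
  · intro x y hxy
    refine ⟨expNegBCF, ⟨BoundedContinuousFunction.toContinuousMapStarₐ ℝ expNegBCF,
      ⟨expNegBCF, ?_, rfl⟩, rfl⟩, ?_⟩
    · exact (hmem _).2 ⟨Polynomial.X, Polynomial.aeval_X _⟩
    · intro hexp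
      have := Real.exp_injective (show Real.exp (-x) = Real.exp (-y) from hexp)
      exact hxy (NNReal.coe_injective (neg_injective this))
  · intro f hf
    obtain ⟨p, rfl⟩ := (hmem f).1 hf
    induction p using Polynomial.induction_on' with
    | add p q hp hq =>
      simp only [map_add, BoundedContinuousFunction.coe_add, Pi.add_apply]
      rw [integral_add (BoundedContinuousFunction.integrable _ _)
        (BoundedContinuousFunction.integrable _ _), integral_add
        (BoundedContinuousFunction.integrable _ _) (BoundedContinuousFunction.integrable _ _),
        hp ((hmem _).2 ⟨p, rfl⟩), hq ((hmem _).2 ⟨q, rfl⟩)]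
    | monomial k a =>
      have hval : ∀ x : ℝ≥0, (Polynomial.aeval expNegBCF (Polynomial.monomial k a)) x =
          a * Real.exp (-(k * x)) := by
        intro x
        rw [Polynomial.aeval_monomial, Algebra.algebraMap_eq_smul_one, smul_mul_assoc, one_mul]
        simp only [BoundedContinuousFunction.coe_smul, BoundedContinuousFunction.coe_pow,
          Pi.pow_apply, expNegBCF_apply, smul_eq_mul, ← Real.exp_nat_mul]
        ring_nf
      simp only [hval]
      have hint (ν : Measure ℝ≥0) : ∫ x : ℝ≥0, Real.exp (-(k * x)) ∂ν =
          (∫⁻ x : ℝ≥0, ENNReal.ofReal (Real.exp (-(k * x))) ∂ν).toReal :=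
        integral_eq_lintegral_of_nonneg_ae (Filter.Eventually.of_forall fun x =>
          (Real.exp_pos _).le) (Measurable.aestronglyMeasurable (by fun_prop))
      rw [integral_const_mul, integral_const_mul, hint, hint, h k]

section LaplaceWeighted

variable {Ω : Type*} [MeasurableSpace Ω] {μ : Measure Ω}

/-- A function of `W` is determined by its Laplace transform. -/
lemma ae_eq_of_laplace_nat {W : Ω → ℝ≥0∞} (hW : AEMeasurable W μ) (hfin : ∀ᵐ ω ∂μ, W ω ≠ ∞)
    {F G : ℝ≥0∞ → ℝ≥0∞} (hF : Measurable F) (hG : Measurable G)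
    (h0 : ∫⁻ ω, G (W ω) ∂μ ≠ ∞)
    (h : ∀ k : ℕ, ∫⁻ ω, ENNReal.ofReal (Real.exp (-(k * (W ω).toReal))) * F (W ω) ∂μ =
      ∫⁻ ω, ENNReal.ofReal (Real.exp (-(k * (W ω).toReal))) * G (W ω) ∂μ) :
    ∀ᵐ ω ∂μ, F (W ω) = G (W ω) := by
  have hw : AEMeasurable (fun ω => (W ω).toNNReal) μ := hW.ennreal_toNNReal
  set ρ := μ.map fun ω => (W ω).toNNReal with hρ
  have hfac : ∀ E : ℝ≥0∞ → ℝ≥0∞, Measurable E → Measurable fun x : ℝ≥0 => E x := fun E hE =>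
    hE.comp measurable_coe_nnreal_ennreal
  have hmap : ∀ E : ℝ≥0∞ → ℝ≥0∞, Measurable E → ∀ k : ℕ,
      ∫⁻ x : ℝ≥0, ENNReal.ofReal (Real.exp (-(k * x))) ∂(ρ.withDensity fun x => E x) =
        ∫⁻ ω, ENNReal.ofReal (Real.exp (-(k * (W ω).toReal))) * E (W ω) ∂μ := by
    intro E hE k
    have hexp : Measurable fun x : ℝ≥0 => ENNReal.ofReal (Real.exp (-(k * x))) := by fun_prop
    rw [lintegral_withDensity_eq_lintegral_mul _ (hfac E hE) hexp, hρ,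
      lintegral_map' ((hfac E hE).mul hexp).aemeasurable hw]
    refine lintegral_congr_ae ?_
    filter_upwards [hfin] with ω hω
    rw [Pi.mul_apply, ENNReal.coe_toNNReal hω, mul_comm]
    rfl
  have hG0 : ∫⁻ x : ℝ≥0, G x ∂ρ ≠ ∞ := by
    have := hmap G hG 0
    simp only [Nat.cast_zero, zero_mul, neg_zero, Real.exp_zero, ENNReal.ofReal_one, one_mul,
      lintegral_one, withDensity_apply _ MeasurableSet.univ, Measure.restrict_univ] at this
    rwa [this]
  have hF0 : ∫⁻ x : ℝ≥0, F x ∂ρ ≠ ∞ := by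
    have h1 := hmap F hF 0
    have h2 := h 0
    simp only [Nat.cast_zero, zero_mul, neg_zero, Real.exp_zero, ENNReal.ofReal_one, one_mul,
      lintegral_one, withDensity_apply _ MeasurableSet.univ, Measure.restrict_univ] at h1 h2
    rwa [h1, h2]
  have : IsFiniteMeasure (ρ.withDensity fun x => F x) := isFiniteMeasure_withDensity hF0
  have : IsFiniteMeasure (ρ.withDensity fun x => G x) := isFiniteMeasure_withDensity hG0
  -- `F` and `G` become densities with respect to the law of `W`; equal transforms give equal
  -- measures, hence almost everywhere equal densities.
  have heq : (ρ.withDensity fun x => F x) = ρ.withDensity fun x => G x :=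
    measure_ext_of_laplace_nat fun k => by rw [hmap F hF, hmap G hG, h k]
  have hae := (withDensity_eq_iff (hfac F hF).aemeasurable (hfac G hG).aemeasurable hF0).1 heq
  filter_upwards [ae_of_ae_map hw hae, hfin] with ω h1 h2
  rwa [ENNReal.coe_toNNReal h2] at h1

/-- If the conditional distribution of `V` given `Z` only depends on `W`, then so do the
conditional expectations of functions of `V` given `Z`. -/
lemma lintegral_mul_of_condDistrib_eq {α β E : Type*} [MeasurableSpace α] [MeasurableSpace β]
    [MeasurableSpace E] [StandardBorelSpace E] [Nonempty E] [IsFiniteMeasure μ]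
    {Z : Ω → α} {W : Ω → β} {V : Ω → E} (hZ : AEMeasurable Z μ) (hV : AEMeasurable V μ)
    (h : ∀ᵐ ω ∂μ, condDistrib V Z μ (Z ω) = condDistrib V W μ (W ω))
    {f : α → ℝ≥0∞} {g : E → ℝ≥0∞} (hf : Measurable f) (hg : Measurable g) :
    ∫⁻ ω, f (Z ω) * g (V ω) ∂μ =
      ∫⁻ ω, f (Z ω) * ∫⁻ v, g v ∂(condDistrib V W μ (W ω)) ∂μ := by
  have hfg : Measurable fun p : α × E => f p.1 * g p.2 := by fun_prop
  have hG : Measurable fun z => ∫⁻ v, g v ∂(condDistrib V Z μ z) := hg.lintegral_kernel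
  calc ∫⁻ ω, f (Z ω) * g (V ω) ∂μ
      = ∫⁻ p, f p.1 * g p.2 ∂(μ.map fun ω => (Z ω, V ω)) :=
        (lintegral_map' hfg.aemeasurable (hZ.prodMk hV)).symm
    _ = ∫⁻ z, f z * ∫⁻ v, g v ∂(condDistrib V Z μ z) ∂(μ.map Z) := by
        rw [← compProd_map_condDistrib hV, Measure.lintegral_compProd hfg]
        exact lintegral_congr fun z => lintegral_const_mul (f z) hg
    _ = ∫⁻ ω, f (Z ω) * ∫⁻ v, g v ∂(condDistrib V Z μ (Z ω)) ∂μ :=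
        lintegral_map' (hf.mul hG).aemeasurable hZ
    _ = _ := lintegral_congr_ae (h.mono fun ω hω => by simp only [hω])

end LaplaceWeighted

/-! ### The contradiction with the Markov property -/

section MarkovProperty

variable {Ω : Type*} [MeasurableSpace Ω] {μ : Measure Ω} [IsProbabilityMeasure μ]
  {Q : Matrix ℕ ℕ ℝ} {X : ℝ≥0 → Ω → ℕ} {Y : ℕ → Ω → ℕ} {H : ℕ → Ω → ℝ≥0}

lemma lintegral_exp_three_occupationTimes (hQ : IsSkipFreeGenerator Q)
    (hJ : IsJumpDescription μ Q 0 X Y H) {i n : ℕ} (hi : i + 2 < n) {s t u : ℝ} (hs : 0 ≤ s)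
    (ht : 0 ≤ t) (hu : 0 ≤ u) :
    ∫⁻ ω, ENNReal.ofReal (Real.exp (-(s * (occupationTime X n i ω).toReal))) *
        (ENNReal.ofReal (Real.exp (-(t * (occupationTime X n (i + 1) ω).toReal))) *
        ENNReal.ofReal (Real.exp (-(u * (occupationTime X n (i + 2) ω).toReal)))) ∂μ =
      ENNReal.ofReal (harmonicSolution Q (threeRates i s t u) n)⁻¹ := by
  rw [← lintegral_exp_occupationTime hQ hJ (threeRates_nonneg hs ht hu) n]
  refine lintegral_congr fun ω => ?_
  rw [← ENNReal.ofReal_mul (Real.exp_pos _).le, ← ENNReal.ofReal_mul (Real.exp_pos _).le,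
    ← Real.exp_add, ← Real.exp_add]
  congr 2
  rw [← Finset.sum_subset (s₁ := {i, i + 1, i + 2})]
  · rw [Finset.sum_insert (by simp), Finset.sum_insert (by simp), Finset.sum_singleton]
    simp only [threeRates, if_true, Nat.succ_ne_self, if_false, Nat.add_eq_left]
    simp
    ring
  · intro j hj
    simp only [Finset.mem_insert, Finset.mem_singleton] at hj
    rw [Finset.mem_range]
    omega
  · intro j _ hj
    simp only [Finset.mem_insert, Finset.mem_singleton] at hj
    rw [threeRates, if_neg (by tauto), if_neg (by tauto), if_neg (by tauto), zero_mul]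

/-- Under the Markov property at `i + 2`, all rates out of `i + 2` to states at most `i` vanish. -/
lemma not_condDistrib_occupationTime_eq (hQ : IsSkipFreeGenerator Q)
    (hJ : IsJumpDescription μ Q 0 X Y H) {i n : ℕ} (hn : i + 2 < n)
    (hi : ∃ j ≤ i, 0 < Q (i + 2) j) :
    ¬ ∀ᵐ ω ∂μ, condDistrib (occupationTime X n (i + 2))
        (fun ω' (j : Fin (i + 2)) => occupationTime X n j ω') μ
        (fun j : Fin (i + 2) => occupationTime X n j ω) =
      condDistrib (occupationTime X n (i + 2)) (occupationTime X n (i + 1)) μ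
        (occupationTime X n (i + 1) ω) := by
  intro hM
  obtain ⟨c, e, d, e', hc, he, he', hsum, hP⟩ := exists_harmonicSolution_threeRates hQ hn hi
  have hmeas := aemeasurable_occupationTime hQ hJ n
  have hLap := fun (s t u : ℝ) hs ht hu =>
    lintegral_exp_three_occupationTimes (μ := μ) (s := s) (t := t) (u := u) hQ hJ hn hs ht hu
  set U := occupationTime X n i
  set W := occupationTime X n (i + 1)
  set V := occupationTime X n (i + 2)
  set q := Q (i + 1) (i + 2)
  have hq : 0 < q := hQ.up_pos (i + 1)
  set p := Q i (i + 1)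
  have hp : 0 < p := hQ.up_pos i
  set L := fun s t u : ℝ => harmonicSolution Q (threeRates i s t u) n with hL
  -- `A` matches the coefficients of `t` in `A * L 0 t 1` and `L 0 (t + γ) 0`, and `γ` then matches
  -- the constant terms. Here `e ≥ 1` gives `γ ≥ 0`, so that `γ` is an admissible killing rate, and
  -- `c > 0` gives `A < 1`.
  set A := e / (e + c) with hA
  set γ := ((1 + c) * A - 1) * q / e with hγ'
  have he0 : 0 < e := by linarith
  have hA0 : 0 < A := by positivity
  have hA1 : A < 1 := (div_lt_one (by positivity)).2 (by linarith)
  have hAc : A * (c + e) = e := by rw [hA]; field_simp; ring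
  have hγq : e * γ = ((1 + c) * A - 1) * q := by rw [hγ']; field_simp
  have hγ : 0 ≤ γ := by
    have : 0 ≤ (1 + c) * A - 1 := by
      rw [hA, mul_div_assoc', sub_nonneg, one_le_div (by positivity)]
      nlinarith
    positivity
  have hLpos : ∀ s t u : ℝ, 0 ≤ s → 0 ≤ t → 0 ≤ u → 0 < L s t u := fun s t u hs ht hu =>
    lt_of_lt_of_le one_pos (one_le_harmonicSolution hQ (threeRates_nonneg hs ht hu) n)
  have hLval : ∀ s t u : ℝ, L s t u * q = (c * u + e) *
      ((t - Q (i + 1) (i + 1)) * (1 + s / p) + Q (i + 1) (i + 1) + q) +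
        (d * (1 + s / p) + e') * q := by
    intro s t u
    have hx : harmonicSolution Q (threeRates i s t u) (i + 1) = 1 + s / p :=
      harmonicSolution_threeRates_one hQ i s t u
    have hy : harmonicSolution Q (threeRates i s t u) (i + 2) * q =
        (t - Q (i + 1) (i + 1)) * (1 + s / p) + Q (i + 1) (i + 1) + q := by
      rw [harmonicSolution_threeRates_two hQ]
      exact div_mul_cancel₀ _ hq.ne'
    simp only [hL]
    rw [hP, hx]
    linear_combination (c * u + e) * hy
  have hshift : ∀ t : ℝ, A * L 0 t 1 = L 0 (t + γ) 0 := by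
    intro t
    refine mul_right_cancel₀ hq.ne' ?_
    rw [mul_assoc, hLval, hLval]
    have hd : d = 1 - e - e' := by linarith
    rw [hd]
    simp only [zero_div, add_zero, mul_one, mul_zero, zero_add]
    linear_combination (t + q) * hAc - hγq - q * hAc
  set φ : ℝ≥0∞ → ℝ≥0∞ := fun v => ENNReal.ofReal (Real.exp (-(1 * v.toReal))) with hφ
  have hexp : ∀ t : ℝ, Measurable fun v : ℝ≥0∞ => ENNReal.ofReal (Real.exp (-(t * v.toReal))) := by
    intro t; fun_prop
  set G : ℝ≥0∞ → ℝ≥0∞ := fun w => ∫⁻ v, φ v ∂(condDistrib V W μ w) with hG'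
  have hGmeas : Measurable G := (hexp 1).lintegral_kernel
  have hZ : AEMeasurable (fun ω (j : Fin (i + 2)) => occupationTime X n j ω) μ :=
    aemeasurable_pi_lambda _ fun j => hmeas j
  have hcond := fun {f : (Fin (i + 2) → ℝ≥0∞) → ℝ≥0∞} (hf : Measurable f) =>
    lintegral_mul_of_condDistrib_eq hZ (hmeas (i + 2)) hM hf (hexp 1)
  -- The conditional mean of `exp (-V)` given `W` is identified by testing against `exp (-k * W)`:
  -- both sides have transform `1 / L 0 k 1`, by `hshift`.
  have hGW : ∀ᵐ ω ∂μ, G (W ω) =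
      ENNReal.ofReal A * ENNReal.ofReal (Real.exp (-(γ * (W ω).toReal))) := by
    refine ae_eq_of_laplace_nat (G := fun w => ENNReal.ofReal A *
      ENNReal.ofReal (Real.exp (-(γ * w.toReal)))) (hmeas (i + 1))
      (ae_occupationTime_ne_top hQ hJ n (i + 1)) hGmeas ((hexp γ).const_mul _) ?_ fun k => ?_
    · have h := hLap 0 γ 0 le_rfl hγ le_rfl
      simp only [zero_mul, neg_zero, Real.exp_zero, ENNReal.ofReal_one, one_mul, mul_one] at h
      rw [lintegral_const_mul' _ _ ENNReal.ofReal_ne_top, h]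
      exact ENNReal.mul_ne_top ENNReal.ofReal_ne_top ENNReal.ofReal_ne_top
    · have h1 := hcond (f := fun z => ENNReal.ofReal (Real.exp (-(k * (z (Fin.last _)).toReal))))
        ((hexp k).comp (measurable_pi_apply _))
      have h2 := hLap 0 k 1 le_rfl k.cast_nonneg zero_le_one
      have h3 := hLap 0 (k + γ) 0 le_rfl (by positivity) le_rfl
      simp only [zero_mul, neg_zero, Real.exp_zero, ENNReal.ofReal_one, one_mul, mul_one] at h2 h3
      have h4 : ∫⁻ ω, ENNReal.ofReal (Real.exp (-(k * (W ω).toReal))) * G (W ω) ∂μ =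
          ENNReal.ofReal (L 0 k 1)⁻¹ := by
        rw [← h2]
        simp only [hG', hφ, one_mul]
        simp only [one_mul] at h1
        exact h1.symm
      rw [h4]
      have h5 : ∀ ω, ENNReal.ofReal (Real.exp (-(k * (W ω).toReal))) *
          (ENNReal.ofReal A * ENNReal.ofReal (Real.exp (-(γ * (W ω).toReal)))) =
          ENNReal.ofReal A * ENNReal.ofReal (Real.exp (-((k + γ) * (W ω).toReal))) := by
        intro ω
        rw [mul_left_comm, ← ENNReal.ofReal_mul (Real.exp_pos _).le, ← Real.exp_add]
        congr 3
        ring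
      refine Eq.symm ((lintegral_congr h5).trans ?_)
      rw [lintegral_const_mul' _ _ ENNReal.ofReal_ne_top, h3, ← ENNReal.ofReal_mul hA0.le]
      congr 1
      have hl1 := hLpos 0 k 1 le_rfl k.cast_nonneg zero_le_one
      change A * (L 0 (k + γ) 0)⁻¹ = (L 0 k 1)⁻¹
      rw [← hshift, mul_inv, mul_inv_cancel_left₀ hA0.ne']
  -- Here the Markov property acts on the past beyond `W`: the same conditional mean is tested
  -- against `exp (-U)`, with `U` the occupation time of `i`.
  have hkey : A * L 1 0 1 = L 1 γ 0 := by
    have h1 := hcond (f := fun z => ENNReal.ofReal (Real.exp (-(1 * (z ⟨i, by omega⟩).toReal))))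
        ((hexp 1).comp (measurable_pi_apply _))
    have h2 := hLap 1 0 1 zero_le_one le_rfl zero_le_one
    have h3 := hLap 1 γ 0 zero_le_one hγ le_rfl
    simp only [zero_mul, neg_zero, Real.exp_zero, ENNReal.ofReal_one, one_mul, mul_one]
      at h1 h2 h3
    have h4 : ENNReal.ofReal (L 1 0 1)⁻¹ = ENNReal.ofReal A * ENNReal.ofReal (L 1 γ 0)⁻¹ := by
      change _ = ENNReal.ofReal (L 1 0 1)⁻¹ at h2
      change _ = ENNReal.ofReal (L 1 γ 0)⁻¹ at h3
      rw [← h2, ← h3, ← lintegral_const_mul' _ _ ENNReal.ofReal_ne_top]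
      refine h1.trans (lintegral_congr_ae ?_)
      filter_upwards [hGW] with ω hω
      rw [mul_left_comm, ← hω]
      simp only [hG', hφ, one_mul]
      rfl
    have hl1 := hLpos 1 0 1 zero_le_one le_rfl zero_le_one
    have hl2 := hLpos 1 γ 0 zero_le_one hγ le_rfl
    rw [← ENNReal.ofReal_mul hA0.le, ENNReal.ofReal_eq_ofReal_iff (by positivity)
      (by positivity)] at h4
    field_simp at h4
    linarith
  have hkey' : A * (L 1 0 1 * q) = L 1 γ 0 * q := by rw [← mul_assoc, hkey]
  have hbase : A * (L 0 0 1 * q) = L 0 γ 0 * q := by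
    rw [← mul_assoc, hshift, zero_add]
  rw [hLval, hLval] at hkey' hbase
  simp only [zero_div, add_zero, mul_one, mul_zero, zero_add, zero_sub] at hkey' hbase
  -- Passing from `s = 0` to `s = 1` multiplies the terms in `d` and `γ` by `1 + 1 / p` but leaves
  -- `e'` unchanged. Subtracting `1 + 1 / p` times the relation for `s = 0` therefore leaves only
  -- `e'`.
  have hcontra : (1 - A) * e' * q * (1 / p) = 0 := by
    linear_combination -(1 / p + 1) * hbase + hkey' +
      ((q + Q (i + 1) (i + 1)) * (1 / p)) * hAc
  have : (1 - A) * e' ≠ 0 := mul_ne_zero (by linarith) he'.ne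
  exact absurd hcontra (by positivity)

end MarkovProperty

end SkipFree

theorem lemma2 (Q : Matrix ℕ ℕ ℝ) (hQ : SkipFree.IsSkipFreeGenerator Q) (n : ℕ)
    (hn : ¬ SkipFree.IsTridiagonal (SkipFree.upperSubmatrix Q n))
    {Ω : Type*} [MeasurableSpace Ω] (μ : MeasureTheory.Measure Ω)
    [MeasureTheory.IsProbabilityMeasure μ] (X : ℝ≥0 → Ω → ℕ)
    (hX : SkipFree.IsMarkovProcessFrom μ Q 0 X) :
    ¬ SkipFree.HasMarkovProperty μ
      (fun i : Fin n => SkipFree.occupationTime X n (i : ℕ)) := by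
  obtain ⟨-, Y, H, hJ⟩ := hX
  simp only [SkipFree.IsTridiagonal, not_forall, SkipFree.upperSubmatrix,
    Matrix.submatrix_apply] at hn
  obtain ⟨a, b, hab, hne⟩ := hn
  -- Skip-freeness excludes entries above the superdiagonal, so the offending entry is a downward
  -- jump of at least two.
  rcases hab with hab | hab
  · exact absurd (hQ.skip_free a b hab) hne
  obtain ⟨i, hi⟩ : ∃ i, (a : ℕ) = i + 2 := ⟨a - 2, by omega⟩
  have hin : i + 2 < n := hi ▸ a.2
  intro hM
  refine SkipFree.not_condDistrib_occupationTime_eq hQ hJ hin ⟨b, by omega, ?_⟩ (hM (i + 1) hin)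
  rw [← hi]
  exact lt_of_le_of_ne (hQ.nonneg_of_ne a b (by omega)) (Ne.symm hne)
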